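/- Let $l\ge 3$, let $\eta=\mathrm{diag}(1,1,-1,\dots,-1)$ be the form of signature $(2,l-1)$ on $\mathbb{R}^{l+1}$, let $G=\mathrm{SO}(2,l-1)$ be the group of real matrices of determinant one preserving $\eta$, let $H=\mathrm{SO}(1,l-1)\subset G$ be the stabilizer of the first basis vector, and let $AdS_l=G/H$ with the quotient topology and the left action of $G$; write $[g]$ for the class of $g$ and $[S]=\{[g]:g\in S\}$ for $S\subset G$. Let $\mathcal G=\mathfrak{so}(2,l-1)$, and let $\sigma$ be the involutive automorphism of $\mathcal G$ given by conjugation with $\mathrm{diag}(1,-1,\dots,-1)$; its $+1$ eigenspace $\mathcal H$ is the Lie algebra of $H$, and its $-1$ eigenspace is denoted $\mathcal Q$. Let $\theta$ be any Cartan involution of $\mathcal G$ that commutes with $\sigma$, with eigenspaces $\mathcal K$ (for $+1$) and $\mathcal P$ (for $-1$). Let $J_1\in\mathcal P\cap\mathcal H$ and $J_2\in\mathcal P\cap\mathcal Q$ commute, put $\mathcal G_{\alpha\beta}=\{X\in\mathcal G:[J_1,X]=\alpha X,\ [J_2,X]=\beta X\}$, and let $0\neq X_{++}\in\mathcal G_{1,1}$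 satisfy $[\theta X_{++},X_{++}]=4(J_1+J_2)$ (this normalizes $J_1$, $J_2$ and $X_{++}$). Put $\mathcal A=\langle J_1,J_2\rangle$, $\mathcal N=\mathcal G_{1,1}\oplus\mathcal G_{1,-1}\oplus\mathcal G_{1,0}\oplus\mathcal G_{0,1}$, $\bar{\mathcal N}=\theta\mathcal N$, and let $A$, $N$, $\bar N$ be the subgroups of $G$ generated by the exponentials of $\mathcal A$, $\mathcal N$, $\bar{\mathcal N}$; $AN$ and $A\bar N$ are subgroups of $G$. Let $q_0$ be the component of $X_{++}$ in $\mathcal K\cap\mathcal Q$, and let $k_\theta=e^{\pi q_0}$. Then $\mathrm{Ad}(k_\theta)=\theta$. The action of $AN$ on $AdS_l$ has exactly two closed orbits, $[AN]$ and $[ANk_\theta]$, and all its other orbits are open. The action of $A\bar N$ on $AdS_l$ has exactly two closed orbits, $[A\bar N]$ and $[A\bar Nk_\theta]$, and all its other orbits are open. Consequently the singularity, defined as the set of the points of $AdS_l$ that lie on a closed orbit of $AN$ or of $A\bar N$, is $[AN]\cup[ANk_\theta]\cup[A\bar N]\cup[A\bar Nk_\theta]$. -/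

import Mathlib

open scoped Matrix Pointwise

attribute [local instance 100] LieRing.ofAssociativeRing

noncomputable section

namespace AdS

/-- Coordinates of `ℝ^{2,l-1}`: two positive directions, then `l - 1` negative ones. -/
abbrev Idx (l : ℕ) : Type := Fin 2 ⊕ Fin (l - 1)

/-- The form `η = diag(1, 1, -1, …, -1)` of signature `(2, l-1)`. -/
abbrev eta (l : ℕ) : Matrix (Idx l) (Idx l) ℝ :=
  LieAlgebra.Orthogonal.indefiniteDiagonal (Fin 2) (Fin (l - 1)) ℝ

/-- The Lie algebra `𝒢 = so(2, l-1)`. -/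
abbrev so (l : ℕ) : LieSubalgebra ℝ (Matrix (Idx l) (Idx l) ℝ) :=
  LieAlgebra.Orthogonal.so' (Fin 2) (Fin (l - 1)) ℝ

/-- The group `SO(2, l-1)`: real matrices of determinant one that preserve `η`. -/
def SO (l : ℕ) : Subgroup (Matrix.SpecialLinearGroup (Idx l) ℝ) where
  carrier := {g | (g : Matrix (Idx l) (Idx l) ℝ)ᵀ * eta l * (g : Matrix (Idx l) (Idx l) ℝ) = eta l}
  one_mem' := by simp
  mul_mem' := by
    intro a b ha hb
    simp only [Set.mem_ofPred_eq, Matrix.SpecialLinearGroup.coe_mul, Matrix.transpose_mul] at *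
    calc _ = (b : Matrix (Idx l) (Idx l) ℝ)ᵀ *
          ((a : Matrix (Idx l) (Idx l) ℝ)ᵀ * eta l * (a : Matrix (Idx l) (Idx l) ℝ)) *
          (b : Matrix (Idx l) (Idx l) ℝ) := by simp only [Matrix.mul_assoc]
      _ = _ := by rw [ha, hb]
  inv_mem' := by
    intro a ha
    simp only [Set.mem_ofPred_eq] at *
    have h : (a : Matrix (Idx l) (Idx l) ℝ) *
        ((a⁻¹ : Matrix.SpecialLinearGroup (Idx l) ℝ) : Matrix (Idx l) (Idx l) ℝ) = 1 := by
      rw [← Matrix.SpecialLinearGroup.coe_mul, mul_inv_cancel, Matrix.SpecialLinearGroup.coe_one]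
    have h' := congrArg Matrix.transpose h
    rw [Matrix.transpose_mul, Matrix.transpose_one] at h'
    conv_lhs => rw [← ha]
    calc _ = (((a⁻¹ : Matrix.SpecialLinearGroup (Idx l) ℝ) : Matrix (Idx l) (Idx l) ℝ)ᵀ *
          (a : Matrix (Idx l) (Idx l) ℝ)ᵀ) * eta l * ((a : Matrix (Idx l) (Idx l) ℝ) *
          ((a⁻¹ : Matrix.SpecialLinearGroup (Idx l) ℝ) : Matrix (Idx l) (Idx l) ℝ)) := by
            simp only [Matrix.mul_assoc]
      _ = _ := by rw [h, h', Matrix.one_mul, Matrix.mul_one]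

/-- The group `G = SO(2, l-1)` as a type (a topological group). -/
abbrev G (l : ℕ) : Type := ↥(SO l)

/-- The underlying matrix of an element of `G`. -/
abbrev G.mat {l : ℕ} (g : G l) : Matrix (Idx l) (Idx l) ℝ :=
  ((g : Matrix.SpecialLinearGroup (Idx l) ℝ) : Matrix (Idx l) (Idx l) ℝ)

/-- The first basis vector of `ℝ^{2,l-1}`. -/
abbrev basePoint (l : ℕ) : Idx l → ℝ := Pi.single (Sum.inl 0) 1

/-- The subgroup `H = SO(1, l-1)` of `G`, which acts on the orthogonal complement of the first
basis vector: the stabilizer of that vector. -/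
def H (l : ℕ) : Subgroup (G l) where
  carrier := {g | g.mat *ᵥ basePoint l = basePoint l}
  one_mem' := Matrix.one_mulVec _
  mul_mem' := by
    intro a b ha hb
    change (a.mat * b.mat) *ᵥ basePoint l = basePoint l
    rw [← Matrix.mulVec_mulVec, show b.mat *ᵥ basePoint l = _ from hb,
      show a.mat *ᵥ basePoint l = _ from ha]
  inv_mem' := by
    intro a ha
    have h : a⁻¹.mat * a.mat = 1 := congrArg G.mat (inv_mul_cancel a)
    change a⁻¹.mat *ᵥ basePoint l = basePoint l
    conv_lhs => rw [← show a.mat *ᵥ basePoint l = _ from ha]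
    rw [Matrix.mulVec_mulVec, h, Matrix.one_mulVec]

/-- Anti de Sitter space `AdS_l = SO(2, l-1) / SO(1, l-1)`, with the quotient topology. -/
abbrev Space (l : ℕ) : Type := G l ⧸ H l

/-- The class `[g]` of `g` in `AdS_l`. -/
abbrev proj {l : ℕ} (g : G l) : Space l := (g : G l ⧸ H l)

/-- `diag(1, -1, …, -1)`. -/
abbrev refl (l : ℕ) : Matrix (Idx l) (Idx l) ℝ :=
  Matrix.diagonal (Sum.elim ![1, -1] (fun _ => -1))

theorem refl_mul_eta (l : ℕ) : refl l * eta l = eta l * refl l := by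
  simp only [refl, eta, LieAlgebra.Orthogonal.indefiniteDiagonal, Matrix.diagonal_mul_diagonal,
    mul_comm]

theorem mem_so_iff {l : ℕ} (X : Matrix (Idx l) (Idx l) ℝ) :
    X ∈ so l ↔ Xᵀ * eta l = -(eta l * X) := by
  rw [so, LieAlgebra.Orthogonal.so', mem_skewAdjointMatricesLieSubalgebra,
    mem_skewAdjointMatricesSubmodule, Matrix.IsSkewAdjoint, Matrix.IsAdjointPair, Matrix.mul_neg]

/-- The involutive automorphism `σ` of `𝒢`. Its fixed algebra is the Lie algebra `ℋ` of `H`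
and its `-1` eigenspace is `𝒬`. -/
def sigma (l : ℕ) : so l →ₗ[ℝ] so l where
  toFun X := ⟨refl l * X * refl l, by
    have hX := (mem_so_iff _).1 X.2
    rw [mem_so_iff, Matrix.transpose_mul, Matrix.transpose_mul, Matrix.diagonal_transpose]
    calc refl l * ((X : Matrix (Idx l) (Idx l) ℝ)ᵀ * refl l) * eta l
        = refl l * (X : Matrix (Idx l) (Idx l) ℝ)ᵀ * (refl l * eta l) := by
          simp only [Matrix.mul_assoc]
      _ = refl l * ((X : Matrix (Idx l) (Idx l) ℝ)ᵀ * eta l) * refl l := by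
          rw [refl_mul_eta]; simp only [Matrix.mul_assoc]
      _ = -((refl l * eta l) * X * refl l) := by
          rw [hX]; simp only [Matrix.mul_assoc, Matrix.mul_neg, Matrix.neg_mul]
      _ = _ := by rw [refl_mul_eta]; simp only [Matrix.mul_assoc]⟩
  map_add' X Y := by ext1; simp [Matrix.mul_add, Matrix.add_mul]
  map_smul' c X := by ext1; simp

/-- A Cartan involution of `𝒢`: an involutive automorphism `θ` for which
`-B(X, θ Y)` is positive definite, where `B` is the Killing form. -/
structure IsCartanInvolution {l : ℕ} (θ : so l ≃ₗ⁅ℝ⁆ so l) : Prop where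
  involutive : ∀ X, θ (θ X) = X
  posDef : ∀ X, X ≠ 0 → 0 < -(killingForm ℝ (so l) X (θ X))

/-- The space `𝒢_{αβ}` of the `X` with `[J₁, X] = α X` and `[J₂, X] = β X`. -/
def rootSpace {l : ℕ} (J₁ J₂ : so l) (α β : ℝ) : Submodule ℝ (so l) where
  carrier := {X | ⁅J₁, X⁆ = α • X ∧ ⁅J₂, X⁆ = β • X}
  add_mem' := by
    rintro X Y ⟨h1, h2⟩ ⟨h3, h4⟩
    exact ⟨by rw [lie_add, h1, h3, smul_add], by rw [lie_add, h2, h4, smul_add]⟩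
  zero_mem' := by simp
  smul_mem' := by
    rintro c X ⟨h1, h2⟩
    exact ⟨by rw [lie_smul, h1, smul_comm], by rw [lie_smul, h2, smul_comm]⟩

/-- The choices that fix the Iwasawa decomposition: a Cartan involution `θ` commuting with `σ`,
commuting elements `J₁ ∈ 𝒫 ∩ ℋ` and `J₂ ∈ 𝒫 ∩ 𝒬` (where `𝒫` is the `-1` eigenspace of `θ`), and a
nonzero root vector `X_{++} ∈ 𝒢_{1,1}` normalized by `[θ X_{++}, X_{++}] = 4 (J₁ + J₂)`. -/
structure IwasawaData (l : ℕ) where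
  θ : so l ≃ₗ⁅ℝ⁆ so l
  cartan : IsCartanInvolution θ
  θ_comm_σ : ∀ X, θ (sigma l X) = sigma l (θ X)
  J₁ : so l
  J₂ : so l
  θ_J₁ : θ J₁ = -J₁
  θ_J₂ : θ J₂ = -J₂
  σ_J₁ : sigma l J₁ = J₁
  σ_J₂ : sigma l J₂ = -J₂
  lie_J₁_J₂ : ⁅J₁, J₂⁆ = 0
  Xpp : so l
  Xpp_ne_zero : Xpp ≠ 0
  Xpp_mem : Xpp ∈ rootSpace J₁ J₂ 1 1
  lie_θ_Xpp : ⁅θ Xpp, Xpp⁆ = (4 : ℝ) • (J₁ + J₂)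

theorem exp_mem_form {l : ℕ} (X : so l) :
    (NormedSpace.exp (X : Matrix (Idx l) (Idx l) ℝ))ᵀ * eta l *
      NormedSpace.exp (X : Matrix (Idx l) (Idx l) ℝ) = eta l := by
  have hη : eta l * eta l = 1 := by
    simp only [eta, LieAlgebra.Orthogonal.indefiniteDiagonal, Matrix.diagonal_mul_diagonal]
    rw [← Matrix.diagonal_one]
    congr 1
    ext i
    rcases i with i | i <;> simp
  have hinv : (eta l)⁻¹ = eta l := Matrix.inv_eq_right_inv hη
  have hu : IsUnit (eta l) := IsUnit.of_mul_eq_one _ hη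
  have hX := (mem_so_iff _).1 X.2
  have hT : (X : Matrix (Idx l) (Idx l) ℝ)ᵀ = eta l * (-X) * (eta l)⁻¹ := by
    rw [hinv, Matrix.mul_neg, ← hX, Matrix.mul_assoc, hη, Matrix.mul_one]
  have hc : Commute (-(X : Matrix (Idx l) (Idx l) ℝ)) X := Commute.neg_left (Commute.refl _)
  rw [← Matrix.exp_transpose, hT, Matrix.exp_conj _ _ hu, hinv, Matrix.mul_assoc _ (eta l) (eta l),
    hη, Matrix.mul_one, Matrix.mul_assoc, ← Matrix.exp_add_of_commute _ _ hc]
  simp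

theorem det_exp {l : ℕ} (X : so l) :
    (NormedSpace.exp (X : Matrix (Idx l) (Idx l) ℝ)).det = 1 := by
  have hne : (eta l).det ≠ 0 := by
    simp only [eta, LieAlgebra.Orthogonal.indefiniteDiagonal, Matrix.det_diagonal]
    refine Finset.prod_ne_zero_iff.2 ?_
    rintro (i | i) - <;> simp
  have key := congrArg Matrix.det (exp_mem_form ((1 / 2 : ℝ) • X))
  rw [Matrix.det_mul, Matrix.det_mul, Matrix.det_transpose] at key
  have h2 : (X : Matrix (Idx l) (Idx l) ℝ) =
      ((1 / 2 : ℝ) • X : so l) + ((1 / 2 : ℝ) • X : so l) := by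
    ext i j
    simp
    ring
  rw [h2, Matrix.exp_add_of_commute _ _ (Commute.refl _), Matrix.det_mul]
  refine mul_right_cancel₀ hne ?_
  rw [one_mul]
  linear_combination key

/-- The exponential map `𝒢 → G`. -/
def exp {l : ℕ} (X : so l) : G l :=
  ⟨⟨NormedSpace.exp (X : Matrix (Idx l) (Idx l) ℝ), det_exp X⟩, exp_mem_form X⟩

/-- The analytic subgroup attached to a subspace of `𝒢`: the group generated by its exponentials. -/
def expSubgroup {l : ℕ} (V : Submodule ℝ (so l)) : Subgroup (G l) :=
  Subgroup.closure (exp '' (V : Set (so l)))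

/-- The orbits of a subgroup of `G` in `AdS_l`. -/
def orbits {l : ℕ} (R : Subgroup (G l)) : Set (Set (Space l)) :=
  Set.range fun x : Space l => MulAction.orbit R x

/-- The closed orbits of a subgroup of `G` in `AdS_l`. -/
def closedOrbits {l : ℕ} (R : Subgroup (G l)) : Set (Set (Space l)) :=
  {O | O ∈ orbits R ∧ IsClosed O}

namespace IwasawaData

variable {l : ℕ} (D : IwasawaData l)

/-- `𝒜`, spanned by `J₁` and `J₂`. -/
def 𝒜 : Submodule ℝ (so l) := Submodule.span ℝ {D.J₁, D.J₂}

/-- `𝒩`, the sum of the root spaces `𝒢_{++}`, `𝒢_{+-}`, `𝒢_{+0}` and `𝒢_{0+}`. -/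
def 𝒩 : Submodule ℝ (so l) :=
  rootSpace D.J₁ D.J₂ 1 1 ⊔ rootSpace D.J₁ D.J₂ 1 (-1) ⊔
    rootSpace D.J₁ D.J₂ 1 0 ⊔ rootSpace D.J₁ D.J₂ 0 1

/-- `𝒩̄ = θ 𝒩`. -/
def 𝒩bar : Submodule ℝ (so l) := D.𝒩.map (D.θ : so l →ₗ[ℝ] so l)

/-- The group `A`. -/
def A : Subgroup (G l) := expSubgroup D.𝒜

/-- The group `N`. -/
def N : Subgroup (G l) := expSubgroup D.𝒩

/-- The group `N̄`. -/
def Nbar : Subgroup (G l) := expSubgroup D.𝒩bar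

/-- The Iwasawa group `R = AN`, as a subgroup of `G`. -/
def R : Subgroup (G l) := D.A ⊔ D.N

/-- The group `R̄ = A N̄`, as a subgroup of `G`. -/
def Rbar : Subgroup (G l) := D.A ⊔ D.Nbar

/-- `q₀`, the component of `X_{++}` in `𝒦 ∩ 𝒬`, where `𝒦` is the fixed algebra of `θ`. -/
def q₀ : so l :=
  (1 / 4 : ℝ) • ((D.Xpp - sigma l D.Xpp) + D.θ (D.Xpp - sigma l D.Xpp))

/-- `k_θ = e^{π q₀}`. -/
def kθ : G l := exp (Real.pi • D.q₀)

/-- The subset `[AN]` of `AdS_l`. -/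
def clsAN : Set (Space l) := proj '' ((D.A : Set (G l)) * (D.N : Set (G l)))

/-- The subset `[AN k_θ]` of `AdS_l`. -/
def clsANk : Set (Space l) := proj '' ((D.A : Set (G l)) * (D.N : Set (G l)) * {D.kθ})

/-- The subset `[A N̄]` of `AdS_l`. -/
def clsANbar : Set (Space l) := proj '' ((D.A : Set (G l)) * (D.Nbar : Set (G l)))

/-- The subset `[A N̄ k_θ]` of `AdS_l`. -/
def clsANbark : Set (Space l) := proj '' ((D.A : Set (G l)) * (D.Nbar : Set (G l)) * {D.kθ})

/-- The singularity: the points of the closed orbits of `AN` and of `A N̄`. -/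
def singularity : Set (Space l) := ⋃₀ (closedOrbits D.R ∪ closedOrbits D.Rbar)

end IwasawaData

end AdS

end

/-! Write `e₀` for the base point and `a ∧ b` for `wedge a b`. The map `v ↦ e₀ ∧ v` identifies
`e₀^⊥` with `𝒬`, and `[g] ↦ g e₀` embeds `AdS_l` in the quadric `η(x, x) = 1`. Everything is done in
these coordinates.

The Iwasawa data amount to three vectors (`exists_hasFrame`): `J₂ = e₀ ∧ w`, `J₁ = ½ u ∧ v`, `X_{++}
= (e₀ - w) ∧ u`, with `η(w, w) = -1`, `u` and `v` null and `η(u, v) = 2`. Then `q₀ = e₀ ∧ a` with `a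
= ½(u + v)` of square `1`, so `k_θ` is the half turn of the positive plane `⟨e₀, a⟩`.

For `Ad(k_θ) = θ`: `θ` induces an involution `T` of `e₀^⊥` with `T a = a` and `T w = -w`. Positivity
of `-B(X, θ X)` forbids a nonzero fixed vector orthogonal to `a`, so `T = -k_θ` (`onQ_eq`). This
settles `𝒬`, and `ℋ` follows because it is determined by its bracket with `𝒬` (`θ_eq_conj`).

For the orbits: `AN` preserves the isotropic flag `⟨u⟩ ⊂ ⟨u, n⟩`, `n = e₀ - w`, with positive
diagonal entries (`R_le_flagSubgroup`). So the sign of `η(u, x)` is invariant, and on `η(u, x) = 0`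
so is the sign of `η(n, x)`, which cannot vanish in signature `(2, l-1)` (`form_n_ne_zero`).
Explicit elements of `A` and `N` carry `x` to `±a` or to `±e₀` (`exists_mulVec_eq_mid`,
`exists_mulVec_eq_basePoint`), so the sign conditions cut out single orbits: two open ones that are
not closed, and two closed ones, through `[1]` and `[k_θ]`. The case of `A N̄` is that of `AN` for
the data transported by `θ` (`opposite`). -/

noncomputable section

namespace AdS

variable {l : ℕ}

/-! ### The form `η` and the wedge model of `so(2, l-1)` -/

/-- The bilinear form on `ℝ^{2,l-1}` attached to `η`. -/
def form (x y : Idx l → ℝ) : ℝ := x ⬝ᵥ (eta l *ᵥ y)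

theorem eta_mulVec_apply (y : Idx l → ℝ) (i : Idx l) :
    (eta l *ᵥ y) i = Sum.elim (fun _ => 1) (fun _ => -1) i * y i := by
  rw [eta, LieAlgebra.Orthogonal.indefiniteDiagonal, Matrix.mulVec_diagonal]

theorem form_eq_sum (x y : Idx l → ℝ) :
    form x y = x (.inl 0) * y (.inl 0) + x (.inl 1) * y (.inl 1) -
      ∑ i : Fin (l - 1), x (.inr i) * y (.inr i) := by
  simp only [form, dotProduct, eta_mulVec_apply, Fintype.sum_sum_type, Fin.sum_univ_two,
    Sum.elim_inl, Sum.elim_inr, neg_mul, one_mul, mul_neg, Finset.sum_neg_distrib]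
  ring

theorem form_comm (x y : Idx l → ℝ) : form x y = form y x := by
  simp only [form_eq_sum, mul_comm]

@[simp] theorem form_add_left (x y z : Idx l → ℝ) : form (x + y) z = form x z + form y z := by
  simp [form, add_dotProduct]

@[simp] theorem form_smul_left (c : ℝ) (x z : Idx l → ℝ) : form (c • x) z = c * form x z := by
  simp [form]

@[simp] theorem form_add_right (x y z : Idx l → ℝ) : form x (y + z) = form x y + form x z := by
  simp [form, Matrix.mulVec_add]

@[simp] theorem form_smul_right (c : ℝ) (x z : Idx l → ℝ) : form x (c • z) = c * form x z := by
  simp [form, Matrix.mulVec_smul]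

@[simp] theorem form_neg_left (x z : Idx l → ℝ) : form (-x) z = -form x z := by
  simp [form]

@[simp] theorem form_neg_right (x z : Idx l → ℝ) : form x (-z) = -form x z := by
  simp [form, Matrix.mulVec_neg]

@[simp] theorem form_sub_left (x y z : Idx l → ℝ) : form (x - y) z = form x z - form y z := by
  simp [form, sub_dotProduct]

@[simp] theorem form_sub_right (x y z : Idx l → ℝ) : form x (y - z) = form x y - form x z := by
  simp [form, Matrix.mulVec_sub]

@[simp] theorem form_zero_left (z : Idx l → ℝ) : form 0 z = 0 := by simp [form]

@[simp] theorem form_zero_right (z : Idx l → ℝ) : form z 0 = 0 := by simp [form]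

theorem form_basePoint_left (x : Idx l → ℝ) : form (basePoint l) x = x (.inl 0) := by
  simp [form_eq_sum]

@[simp] theorem form_basePoint_self : form (basePoint l) (basePoint l) = 1 := by
  simp [form_basePoint_left]

theorem form_mulVec_left (X : so l) (x y : Idx l → ℝ) :
    form (X.1 *ᵥ x) y = -form x (X.1 *ᵥ y) := by
  have hX := (mem_so_iff _).1 X.2
  rw [form, form, ← Matrix.vecMul_transpose, ← Matrix.dotProduct_mulVec, Matrix.mulVec_mulVec, hX,
    Matrix.neg_mulVec, dotProduct_neg, Matrix.mulVec_mulVec]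

theorem form_group (g : G l) (x y : Idx l → ℝ) :
    form (g.mat *ᵥ x) (g.mat *ᵥ y) = form x y := by
  have h : g.matᵀ * eta l * g.mat = eta l := g.2
  rw [form, form, ← Matrix.vecMul_transpose, ← Matrix.dotProduct_mulVec, Matrix.mulVec_mulVec,
    Matrix.mulVec_mulVec, h]

theorem so_ext {X Y : so l} (h : ∀ x, X.1 *ᵥ x = Y.1 *ᵥ x) : X = Y :=
  Subtype.ext (Matrix.ext_iff_mulVec.2 h)

theorem lie_mulVec (X Y : so l) (x : Idx l → ℝ) :
    (⁅X, Y⁆ : so l).1 *ᵥ x = X.1 *ᵥ (Y.1 *ᵥ x) - Y.1 *ᵥ (X.1 *ᵥ x) := by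
  rw [LieSubalgebra.coe_bracket, Ring.lie_def, Matrix.sub_mulVec, Matrix.mulVec_mulVec,
    Matrix.mulVec_mulVec]

@[simp] theorem so_add_mulVec (X Y : so l) (x : Idx l → ℝ) :
    (X + Y).1 *ᵥ x = X.1 *ᵥ x + Y.1 *ᵥ x := Matrix.add_mulVec _ _ _

@[simp] theorem so_sub_mulVec (X Y : so l) (x : Idx l → ℝ) :
    (X - Y).1 *ᵥ x = X.1 *ᵥ x - Y.1 *ᵥ x := Matrix.sub_mulVec _ _ _

@[simp] theorem so_neg_mulVec (X : so l) (x : Idx l → ℝ) :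
    (-X).1 *ᵥ x = -(X.1 *ᵥ x) := Matrix.neg_mulVec _ _

@[simp] theorem so_smul_mulVec (c : ℝ) (X : so l) (x : Idx l → ℝ) :
    (c • X).1 *ᵥ x = c • (X.1 *ᵥ x) := Matrix.smul_mulVec _ _ _

@[simp] theorem so_zero_mulVec (x : Idx l → ℝ) : (0 : so l).1 *ᵥ x = 0 := Matrix.zero_mulVec _

/-- The element `a ∧ b` of `so(2, l-1)`, `x ↦ η(b, x) a - η(a, x) b`. -/
def wedge (a b : Idx l → ℝ) : so l :=
  ⟨Matrix.vecMulVec a (eta l *ᵥ b) - Matrix.vecMulVec b (eta l *ᵥ a), by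
    rw [mem_so_iff]
    ext i j
    simp only [eta, LieAlgebra.Orthogonal.indefiniteDiagonal, Matrix.mul_diagonal,
      Matrix.diagonal_mul, Matrix.mulVec_diagonal, Matrix.transpose_apply, Matrix.sub_apply,
      Matrix.vecMulVec_apply, Matrix.neg_apply]
    ring⟩

@[simp] theorem wedge_mulVec (a b x : Idx l → ℝ) :
    (wedge a b).1 *ᵥ x = form b x • a - form a x • b := by
  have h (a b : Idx l → ℝ) : Matrix.vecMulVec a (eta l *ᵥ b) *ᵥ x = form b x • a := by
    rw [form_comm, form, Matrix.vecMulVec_mulVec, dotProduct_comm]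
    ext i
    simp [mul_comm]
  rw [wedge, Matrix.sub_mulVec, h, h]

/-- Under `Λ² ≅ so(2, l-1)` the adjoint action is the derivation induced by the vector
representation; the explicit brackets below reduce to this. -/
theorem lie_wedge (X : so l) (a b : Idx l → ℝ) :
    ⁅X, wedge a b⁆ = wedge (X.1 *ᵥ a) b + wedge a (X.1 *ᵥ b) := by
  refine so_ext fun x => ?_
  simp only [lie_mulVec, wedge_mulVec, so_add_mulVec, Matrix.mulVec_sub, Matrix.mulVec_smul,
    form_mulVec_left]
  module

theorem sigma_mulVec (X : so l) (x : Idx l → ℝ) :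
    (sigma l X).1 *ᵥ x = refl l *ᵥ (X.1 *ᵥ (refl l *ᵥ x)) := by
  simp [sigma, Matrix.mulVec_mulVec, Matrix.mul_assoc]

theorem refl_mulVec (x : Idx l → ℝ) :
    refl l *ᵥ x = (2 * form (basePoint l) x) • basePoint l - x := by
  ext i
  rw [refl, Matrix.mulVec_diagonal, form_basePoint_left]
  rcases i with i | i
  · fin_cases i <;> simp; ring
  · simp

theorem form_basePoint_mulVec (X : so l) : form (basePoint l) (X.1 *ᵥ basePoint l) = 0 := by
  have := form_mulVec_left X (basePoint l) (basePoint l)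
  rw [form_comm] at this; linarith

theorem refl_mulVec_refl_mulVec (x : Idx l → ℝ) : refl l *ᵥ (refl l *ᵥ x) = x := by
  simp only [refl_mulVec, form_sub_right, form_smul_right, form_basePoint_self]; module

theorem sigma_sigma (X : so l) : sigma l (sigma l X) = X :=
  so_ext fun x => by simp only [sigma_mulVec, refl_mulVec_refl_mulVec]

theorem sigma_lie (X Y : so l) : sigma l ⁅X, Y⁆ = ⁅sigma l X, sigma l Y⁆ := by
  refine so_ext fun x => ?_
  simp only [sigma_mulVec, lie_mulVec, Matrix.mulVec_sub, refl_mulVec_refl_mulVec]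

/-- `X` commutes with the reflection whose fixed line is spanned by `e₀`, so `X e₀` lies on that
line; skewness makes it orthogonal to `e₀`. -/
theorem mulVec_basePoint_of_sigma_eq {X : so l} (h : sigma l X = X) :
    X.1 *ᵥ basePoint l = 0 := by
  have h1 := sigma_mulVec X (basePoint l)
  have h2 := form_basePoint_mulVec X
  rw [h, refl_mulVec, refl_mulVec, Matrix.mulVec_sub, Matrix.mulVec_smul] at h1
  simp only [form_basePoint_self, form_sub_right, form_smul_right, h2] at h1
  have h3 : (2 : ℝ) • (X.1 *ᵥ basePoint l) = 0 := by
    linear_combination (norm := module) h1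
  simpa using h3

/-- An element of `𝒬` anticommutes with the reflection, so it exchanges `e₀^⊥` and the line of `e₀`,
and by skewness its value at `e₀` determines it. This identifies `𝒬` with `e₀^⊥`. -/
theorem eq_wedge_of_sigma_eq_neg {X : so l} (h : sigma l X = -X) :
    X = wedge (basePoint l) (-(X.1 *ᵥ basePoint l)) := by
  refine so_ext fun x => ?_
  have h1 := sigma_mulVec X x
  have h2 := form_basePoint_mulVec X
  have h3 := form_mulVec_left X (basePoint l) x
  rw [h, refl_mulVec, refl_mulVec, Matrix.mulVec_sub, Matrix.mulVec_smul] at h1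
  simp only [form_sub_right, form_smul_right, h2, so_neg_mulVec] at h1
  simp only [wedge_mulVec, form_neg_left, h3]
  have h4 : (2 : ℝ) • (X.1 *ᵥ x) = (2 : ℝ) • (- -form (basePoint l) (X.1 *ᵥ x) • basePoint l -
    form (basePoint l) x • -(X.1 *ᵥ basePoint l)) := by
    linear_combination (norm := module) -h1
  exact smul_right_injective _ two_ne_zero h4

theorem sigma_wedge_basePoint {v : Idx l → ℝ} (hv : form (basePoint l) v = 0) :
    sigma l (wedge (basePoint l) v) = -wedge (basePoint l) v := by
  refine so_ext fun x => ?_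
  have hv' := hv
  rw [form_comm] at hv'
  simp only [sigma_mulVec, refl_mulVec, wedge_mulVec, so_neg_mulVec, form_sub_right,
    form_smul_right, form_basePoint_self, hv, hv']
  module

/-- The form is negative definite on the orthogonal complement of a positive plane. -/
theorem form_self_neg {a y : Idx l → ℝ} (ha : form (basePoint l) a = 0) (ha1 : form a a = 1)
    (hy : form (basePoint l) y = 0) (hay : form a y = 0) (hne : y ≠ 0) : form y y < 0 := by
  rw [form_basePoint_left] at ha hy
  rw [form_eq_sum, ha] at ha1 hay
  rw [form_eq_sum, hy]
  have cs := Finset.sum_mul_sq_le_sq_mul_sq Finset.univ (fun i : Fin (l - 1) => a (.inr i))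
    (fun i => y (.inr i))
  have hs : ∀ v : Idx l → ℝ, ∑ i : Fin (l - 1), v (.inr i) * v (.inr i) =
    ∑ i : Fin (l - 1), v (.inr i) ^ 2 := fun v => by simp only [sq]
  rw [hs] at ha1 ⊢
  set p := a (.inl 1)
  set q := y (.inl 1)
  set d := ∑ i : Fin (l - 1), y (.inr i) ^ 2 with hd
  have hd0 : 0 ≤ d := Finset.sum_nonneg fun i _ => sq_nonneg _
  have e1 : ∑ i : Fin (l - 1), a (.inr i) * y (.inr i) = p * q := by linarith
  have e2 : ∑ i : Fin (l - 1), a (.inr i) ^ 2 = p ^ 2 - 1 := by linarith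
  rw [e1, e2] at cs
  have hp : 1 ≤ p ^ 2 := by
    have : 0 ≤ ∑ i : Fin (l - 1), a (.inr i) ^ 2 := Finset.sum_nonneg fun i _ => sq_nonneg _
    linarith
  -- Cauchy–Schwarz on the negative coordinates reads `(p q)² ≤ (p² - 1) d`; since `p² ≥ 1`, it
  -- forces `q² ≤ d`.
  have key : p ^ 2 * (q ^ 2 - d) ≤ -d := by nlinarith
  have hle : q ^ 2 - d ≤ 0 := by
    by_contra hcon
    push Not at hcon
    nlinarith
  by_contra hcon
  have h0 : q ^ 2 - d = 0 := le_antisymm hle (by nlinarith)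
  have hd1 : d = 0 := by rw [h0] at key; linarith
  have hq : q = 0 := by
    have : q ^ 2 = 0 := by linarith
    simpa using this
  apply hne
  ext i
  rcases i with i | i
  · fin_cases i
    · exact hy
    · exact hq
  · have := (Finset.sum_eq_zero_iff_of_nonneg (fun i _ => sq_nonneg (y (.inr i)))).1
      (hd.symm.trans hd1) i (Finset.mem_univ _)
    simpa using this

theorem wedge_smul_right (c : ℝ) (a b : Idx l → ℝ) : wedge a (c • b) = c • wedge a b :=
  so_ext fun x => by simp only [wedge_mulVec, so_smul_mulVec, form_smul_left]; module

theorem wedge_smul_left (c : ℝ) (a b : Idx l → ℝ) : wedge (c • a) b = c • wedge a b :=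
  so_ext fun x => by simp only [wedge_mulVec, so_smul_mulVec, form_smul_left]; module

theorem wedge_add_right (a b c : Idx l → ℝ) : wedge a (b + c) = wedge a b + wedge a c :=
  so_ext fun x => by simp only [wedge_mulVec, so_add_mulVec, form_add_left]; module

theorem wedge_basePoint_mulVec {v : Idx l → ℝ} (hv : form (basePoint l) v = 0) :
    (wedge (basePoint l) v).1 *ᵥ basePoint l = -v := by
  rw [wedge_mulVec, form_comm, hv, form_basePoint_self]; module

theorem wedge_basePoint_injective {v v' : Idx l → ℝ} (hv : form (basePoint l) v = 0)
    (hv' : form (basePoint l) v' = 0) (h : wedge (basePoint l) v = wedge (basePoint l) v') :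
    v = v' := by
  have := wedge_basePoint_mulVec hv
  rw [h, wedge_basePoint_mulVec hv'] at this
  exact (neg_injective this).symm

/-! ### Frames: the Iwasawa data in terms of vectors -/

/-- The Gram relations for which `e₀ ± w`, `u` and `v` are null weight vectors. -/
structure IsFrame (w u v : Idx l → ℝ) : Prop where
  bw : form (basePoint l) w = 0
  bu : form (basePoint l) u = 0
  bv : form (basePoint l) v = 0
  ww : form w w = -1
  wu : form w u = 0
  wv : form w v = 0
  uu : form u u = 0
  vv : form v v = 0
  uv : form u v = 2

/-- The structure of a nonzero root vector of weight `(1, 1)`. -/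
theorem exists_eq_wedge_of_mem_rootSpace {J₁ J₂ X : so l} {w : Idx l → ℝ}
    (hw : form (basePoint l) w = 0) (hJ₁ : sigma l J₁ = J₁) (hJ₂ : J₂ = wedge (basePoint l) w)
    (hX : X ∈ rootSpace J₁ J₂ 1 1) (hne : X ≠ 0) :
    form w w = -1 ∧ ∃ u : Idx l → ℝ, form (basePoint l) u = 0 ∧ form w u = 0 ∧ form u u = 0 ∧
      X = wedge (basePoint l - w) u ∧ X - sigma l X = (2 : ℝ) • wedge (basePoint l) u := by
  obtain ⟨h1, h2⟩ := hX
  rw [one_smul] at h1 h2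
  have hs2 : sigma l J₂ = -J₂ := by rw [hJ₂, sigma_wedge_basePoint hw]
  have h1' : ⁅J₁, sigma l X⁆ = sigma l X := by
    nth_rw 1 [← hJ₁]; rw [← sigma_lie, h1]
  have h2' : ⁅J₂, sigma l X⁆ = -sigma l X := by
    have := sigma_lie J₂ X
    rw [hs2, h2, neg_lie] at this
    exact (neg_eq_iff_eq_neg.2 this).symm
  -- `Y` is the `𝒬`-component of `X`. As `σ` reverses `J₂`, `σ X` has weight `-1` for `J₂`, so `[J₂,
  -- Y]` is the `ℋ`-component and `ad(J₂)² Y = Y`.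
  set Y := (1 / 2 : ℝ) • (X - sigma l X) with hY
  have hsY : sigma l Y = -Y := by
    rw [hY, map_smul, map_sub, sigma_sigma]; module
  have hYw := eq_wedge_of_sigma_eq_neg hsY
  set u := -(Y.1 *ᵥ basePoint l) with hu
  have hbu : form (basePoint l) u = 0 := by
    rw [hu, form_neg_right, form_basePoint_mulVec, neg_zero]
  have hJY : ⁅J₂, Y⁆ = (1 / 2 : ℝ) • (X + sigma l X) := by
    rw [hY, lie_smul, lie_sub, h2, h2', sub_neg_eq_add]
  have hJJY : ⁅J₂, ⁅J₂, Y⁆⁆ = Y := by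
    rw [hJY, lie_smul, lie_add, h2, h2', ← sub_eq_add_neg]
  have hXY : X = Y + ⁅J₂, Y⁆ := by rw [hJY, hY]; module
  have huw : form u w = form w u := form_comm _ _
  have hu0 : u ≠ 0 := by
    intro h0
    have hY0 : Y = 0 := by
      rw [hYw, h0]; exact so_ext fun x => by simp
    rw [hY0, lie_zero, add_zero] at hXY
    exact hne hXY
  have e1 : ⁅J₂, Y⁆ = -wedge w u := by
    rw [hYw, lie_wedge, hJ₂, wedge_basePoint_mulVec hw]
    refine so_ext fun x => ?_
    simp only [so_add_mulVec, so_neg_mulVec, wedge_mulVec, hbu, form_sub_left, form_smul_left,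
      form_neg_left]
    module
  -- The relation `ad(J₂)² Y = Y` evaluated at `e₀`. Pairing it with `w` gives `η(w, u) = 0`, and
  -- then `η(w, w) = -1` because `u ≠ 0`.
  have e2 : u = -form w w • u + form w u • w := by
    rw [e1, hYw, hJ₂] at hJJY
    have h3 := congrArg (fun Z : so l => Z.1 *ᵥ basePoint l) hJJY
    simp only [ lie_mulVec, so_neg_mulVec, wedge_mulVec] at h3
    have hwb : form w (basePoint l) = 0 := by rw [form_comm, hw]
    have hub : form u (basePoint l) = 0 := by rw [form_comm, hbu]
    simp only [hwb, hub, form_basePoint_self, form_sub_right, form_smul_right, form_neg_right, hw,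
      hbu, huw] at h3
    linear_combination (norm := module) h3
  have hwu : form w u = 0 := by
    have := congrArg (form w) e2
    simp only [form_add_right, form_smul_right] at this
    linarith
  have hww : form w w = -1 := by
    rw [hwu] at e2
    have h4 : (1 + form w w) • u = 0 := by linear_combination (norm := module) e2
    rcases smul_eq_zero.1 h4 with h | h
    · linarith
    · exact absurd h hu0
  have hJ1Y : ⁅J₁, Y⁆ = Y := by rw [hY, lie_smul, lie_sub, h1, h1']
  have hJu : J₁.1 *ᵥ u = u := by
    rw [hYw, lie_wedge, mulVec_basePoint_of_sigma_eq hJ₁] at hJ1Y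
    have h5 := congrArg (fun Z : so l => Z.1 *ᵥ basePoint l) hJ1Y
    have hb : form (J₁.1 *ᵥ u) (basePoint l) = 0 := by
      rw [form_mulVec_left, mulVec_basePoint_of_sigma_eq hJ₁, form_zero_right, neg_zero]
    have hub : form u (basePoint l) = 0 := by rw [form_comm, hbu]
    simp only [so_add_mulVec, wedge_mulVec, hb, hub, form_basePoint_self, form_zero_left] at h5
    linear_combination (norm := module) -h5
  have huu : form u u = 0 := by
    have := form_mulVec_left J₁ u u
    rw [hJu] at this; linarith
  refine ⟨hww, u, hbu, hwu, huu, ?_, ?_⟩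
  · rw [hXY, e1, hYw]
    refine so_ext fun x => ?_
    simp only [so_add_mulVec, so_neg_mulVec, wedge_mulVec, form_sub_left]
    module
  · rw [← hYw, hY]; module

namespace IwasawaData

variable (D : IwasawaData l)

theorem θ_mem_rootSpace {α β : ℝ} {X : so l} (hX : X ∈ rootSpace D.J₁ D.J₂ α β) :
    D.θ X ∈ rootSpace (-D.J₁) (-D.J₂) α β := by
  obtain ⟨h1, h2⟩ := hX
  refine ⟨?_, ?_⟩
  · rw [← D.θ_J₁, ← LieEquiv.map_lie, h1, map_smul]
  · rw [← D.θ_J₂, ← LieEquiv.map_lie, h2, map_smul]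

/-- The Iwasawa data with `J₁`, `J₂`, `X_{++}` replaced by their images under `θ`. -/
def opposite : IwasawaData l where
  θ := D.θ
  cartan := D.cartan
  θ_comm_σ := D.θ_comm_σ
  J₁ := -D.J₁
  J₂ := -D.J₂
  θ_J₁ := by rw [map_neg, D.θ_J₁]
  θ_J₂ := by rw [map_neg, D.θ_J₂]
  σ_J₁ := by rw [map_neg, D.σ_J₁]
  σ_J₂ := by rw [map_neg, D.σ_J₂]
  lie_J₁_J₂ := by rw [neg_lie, lie_neg, D.lie_J₁_J₂, neg_zero, neg_zero]
  Xpp := D.θ D.Xpp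
  Xpp_ne_zero := by simpa using D.Xpp_ne_zero
  Xpp_mem := D.θ_mem_rootSpace D.Xpp_mem
  lie_θ_Xpp := by
    rw [D.cartan.involutive, ← lie_skew, D.lie_θ_Xpp]; module

/-- The description of the Iwasawa data in terms of a frame. -/
structure HasFrame (w u v : Idx l → ℝ) : Prop extends IsFrame w u v where
  J₁_eq : D.J₁ = (1 / 2 : ℝ) • wedge u v
  J₂_eq : D.J₂ = wedge (basePoint l) w
  θ_wedge : D.θ (wedge (basePoint l) u) = wedge (basePoint l) v
  q₀_eq : D.q₀ = wedge (basePoint l) ((1 / 2 : ℝ) • (u + v))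

theorem exists_hasFrame : ∃ w u v : Idx l → ℝ, D.HasFrame w u v := by
  have hJ₂ := eq_wedge_of_sigma_eq_neg D.σ_J₂
  set w := -(D.J₂.1 *ᵥ basePoint l) with hw
  have hbw : form (basePoint l) w = 0 := by
    rw [hw, form_neg_right, form_basePoint_mulVec, neg_zero]
  obtain ⟨hww, u, hbu, hwu, huu, hX, hXs⟩ :=
    exists_eq_wedge_of_mem_rootSpace hbw D.σ_J₁ hJ₂ D.Xpp_mem D.Xpp_ne_zero
  have hJ₂' : -D.J₂ = wedge (basePoint l) (-w) := by
    rw [hJ₂, ← neg_one_smul ℝ w, wedge_smul_right, neg_one_smul]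
  -- The same structure result for `θ X_{++}`, a root vector for `-J₁`, `-J₂`; here `-w` replaces
  -- `w`, so `θ X_{++} = (e₀ + w) ∧ v`.
  obtain ⟨-, v, hbv, hwv, hvv, hX', hXs'⟩ :=
    exists_eq_wedge_of_mem_rootSpace (by simpa using hbw) D.opposite.σ_J₁ hJ₂'
      D.opposite.Xpp_mem D.opposite.Xpp_ne_zero
  change D.θ D.Xpp = _ at hX'
  change D.θ D.Xpp - sigma l (D.θ D.Xpp) = _ at hXs'
  have hwv : form w v = 0 := by simpa using hwv
  have hwb : form w (basePoint l) = 0 := by rw [form_comm, hbw]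
  have hub : form u (basePoint l) = 0 := by rw [form_comm, hbu]
  have hvb : form v (basePoint l) = 0 := by rw [form_comm, hbv]
  have hvu : form v u = form u v := form_comm _ _
  have hvw : form v w = 0 := by rw [form_comm, hwv]
  have hJ := D.lie_θ_Xpp
  have hbr : ⁅D.θ D.Xpp, D.Xpp⁆ = (2 * form u v) • D.J₂ - (2 : ℝ) • wedge v u := by
    rw [hX', hX, lie_wedge, hJ₂]
    refine so_ext fun x => ?_
    simp only [so_add_mulVec, so_sub_mulVec, so_smul_mulVec, wedge_mulVec, form_sub_left,
      form_sub_right, form_neg_left, form_smul_left, form_basePoint_self, hww, hwb, hbw, hvu, hvb,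
      hbu, hwu, hvw]
    module
  rw [hbr] at hJ
  -- `J₁` and `v ∧ u` kill `e₀`, so evaluating the normalization at `e₀` compares only the
  -- coefficients of `J₂`: `2 η(u, v) = 4`.
  have huv : form u v = 2 := by
    have h6 := congrArg (fun Z : so l => form w (Z.1 *ᵥ basePoint l)) hJ
    simp only [so_sub_mulVec, so_smul_mulVec, so_add_mulVec, wedge_mulVec,
      mulVec_basePoint_of_sigma_eq D.σ_J₁, hub, hvb, form_sub_right, form_smul_right,
      form_add_right, form_zero_right] at h6
    rw [hJ₂, wedge_basePoint_mulVec hbw, form_neg_right, hww] at h6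
    linarith
  have hθ : D.θ (wedge (basePoint l) u) = wedge (basePoint l) v := by
    refine smul_right_injective _ (two_ne_zero (α := ℝ)) ?_
    change (2 : ℝ) • _ = (2 : ℝ) • _
    rw [← hXs', ← map_smul, ← hXs, map_sub, D.θ_comm_σ]
  refine ⟨w, u, v, ⟨hbw, hbu, hbv, hww, hwu, hwv, huu, hvv, huv⟩, ?_, hJ₂, hθ, ?_⟩
  · refine smul_right_injective _ (four_ne_zero (α := ℝ)) ?_
    change (4 : ℝ) • _ = (4 : ℝ) • _
    have h7 : wedge v u = -wedge u v :=
      so_ext fun x => by simp only [wedge_mulVec, so_neg_mulVec]; module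
    rw [huv, h7] at hJ
    linear_combination (norm := module) -hJ
  · rw [q₀, hXs, map_smul, hθ, wedge_smul_right, wedge_add_right]
    module

end IwasawaData

/-! ### Exponentials acting on vectors -/

/-- Stated entrywise so that no norm on matrices enters the statement; one is chosen only inside the
proof. -/
theorem hasDerivAt_exp_smul_entry {n : Type*} [Fintype n] [DecidableEq n] (M : Matrix n n ℝ)
    (s : ℝ) (i j : n) :
    HasDerivAt (fun s : ℝ => NormedSpace.exp (s • M) i j)
      ((NormedSpace.exp (s • M) * M) i j) s := by
  let _ : NormedRing (Matrix n n ℝ) := Matrix.linftyOpNormedRing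
  let _ : NormedAlgebra ℝ (Matrix n n ℝ) := Matrix.linftyOpNormedAlgebra
  have h := hasDerivAt_exp_smul_const (𝕂 := ℝ) M s
  let L : Matrix n n ℝ →L[ℝ] ℝ := LinearMap.toContinuousLinearMap (Matrix.entryLinearMap ℝ ℝ i j)
  exact L.hasFDerivAt.comp_hasDerivAt s h

/-- Solutions of `c' = M c` are given by the exponential. -/
theorem exp_smul_mulVec_of_hasDerivAt {n : Type*} [Fintype n] [DecidableEq n] (M : Matrix n n ℝ)
    (c : ℝ → n → ℝ) (hc : ∀ t, HasDerivAt c (M *ᵥ c t) t) (t : ℝ) :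
    NormedSpace.exp (t • M) *ᵥ c 0 = c t := by
  have hE (s : ℝ) (i j : n) : HasDerivAt (fun s : ℝ => NormedSpace.exp ((-s) • M) i j)
      (-(NormedSpace.exp ((-s) • M) * M) i j) s := by
    refine ((hasDerivAt_exp_smul_entry M (-s) i j).comp s (hasDerivAt_neg s)).congr_deriv ?_
    simp
  -- `exp(-sM) c(s)` has zero derivative, hence is constant.
  have hf (s : ℝ) (i : n) :
      HasDerivAt (fun s => (NormedSpace.exp ((-s) • M) *ᵥ c s) i) 0 s := by
    have h1 := HasDerivAt.fun_sum (u := Finset.univ) fun j _ =>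
      (hE s i j).mul (hasDerivAt_pi.1 (hc s) j)
    refine h1.congr_deriv ?_
    rw [Finset.sum_add_distrib]
    have e1 : ∑ j, NormedSpace.exp ((-s) • M) i j * (M *ᵥ c s) j =
        ((NormedSpace.exp ((-s) • M) * M) *ᵥ c s) i := by
      rw [← Matrix.mulVec_mulVec]; rfl
    rw [e1]
    simp [Matrix.mulVec, dotProduct]
  have hconst (i : n) := is_const_of_deriv_eq_zero
    (fun s => (hf s i).differentiableAt) (fun s => (hf s i).deriv) t 0
  have h2 : NormedSpace.exp (-(t • M)) *ᵥ c t = c 0 := by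
    ext i
    simpa using hconst i
  rw [← h2, Matrix.mulVec_mulVec, 
    ← Matrix.exp_add_of_commute (t • M) (-(t • M)) (Commute.neg_right (Commute.refl _))]
  simp

theorem exp_mulVec_of_hasDerivAt (X : so l) (c : ℝ → Idx l → ℝ)
    (hc : ∀ t, HasDerivAt c (X.1 *ᵥ c t) t) (t : ℝ) : (exp (t • X)).mat *ᵥ c 0 = c t :=
  exp_smul_mulVec_of_hasDerivAt X.1 c hc t

theorem exp_smul_mulVec_of_eigenvector {X : so l} {x : Idx l → ℝ} {a : ℝ} (h : X.1 *ᵥ x = a • x)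
    (t : ℝ) : (exp (t • X)).mat *ᵥ x = Real.exp (t * a) • x := by
  have := exp_mulVec_of_hasDerivAt X (fun t => Real.exp (t * a) • x) (fun t => by
    have h1 : HasDerivAt (fun t : ℝ => Real.exp (t * a)) (Real.exp (t * a) * (1 * a)) t :=
      ((hasDerivAt_id t).mul_const a).exp
    refine (h1.smul_const x).congr_deriv ?_
    rw [Matrix.mulVec_smul, h, smul_smul, one_mul]) t
  simpa using this

theorem exp_mulVec_of_eigenvector {X : so l} {x : Idx l → ℝ} {a : ℝ} (h : X.1 *ᵥ x = a • x) :
    (exp X).mat *ᵥ x = Real.exp a • x := by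
  simpa using exp_smul_mulVec_of_eigenvector h 1

/-- The exponential acts through the first three terms of the series on a vector killed by `X³`. -/
theorem exp_mulVec_of_cube_eq_zero {X : so l} {x : Idx l → ℝ}
    (h : X.1 *ᵥ (X.1 *ᵥ (X.1 *ᵥ x)) = 0) :
    (exp X).mat *ᵥ x = x + X.1 *ᵥ x + (1 / 2 : ℝ) • (X.1 *ᵥ (X.1 *ᵥ x)) := by
  have := exp_mulVec_of_hasDerivAt X
    (fun t => x + t • (X.1 *ᵥ x) + (t ^ 2 / 2) • (X.1 *ᵥ (X.1 *ᵥ x))) (fun t => by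
    have h1 : HasDerivAt (fun t : ℝ => t ^ 2 / 2) t t := by
      simpa using (hasDerivAt_pow 2 t).div_const 2
    refine ((((hasDerivAt_id t).smul_const (X.1 *ᵥ x)).const_add x).add
      (h1.smul_const (X.1 *ᵥ (X.1 *ᵥ x)))).congr_deriv ?_
    simp only [Matrix.mulVec_add, Matrix.mulVec_smul, h]
    module) 1
  simpa using this

/-- The exponential of a rotation. -/
theorem exp_smul_mulVec_of_cube_eq_neg {X : so l} {x : Idx l → ℝ}
    (h : X.1 *ᵥ (X.1 *ᵥ (X.1 *ᵥ x)) = -(X.1 *ᵥ x)) (t : ℝ) :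
    (exp (t • X)).mat *ᵥ x =
      x + Real.sin t • (X.1 *ᵥ x) + (1 - Real.cos t) • (X.1 *ᵥ (X.1 *ᵥ x)) := by
  have := exp_mulVec_of_hasDerivAt X
    (fun t => x + Real.sin t • (X.1 *ᵥ x) + (1 - Real.cos t) • (X.1 *ᵥ (X.1 *ᵥ x))) (fun t => by
    refine ((((Real.hasDerivAt_sin t).smul_const (X.1 *ᵥ x)).const_add x).add
      (((Real.hasDerivAt_cos t).const_sub 1).smul_const (X.1 *ᵥ (X.1 *ᵥ x)))).congr_deriv ?_
    simp only [Matrix.mulVec_add, Matrix.mulVec_smul, h]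
    module) t
  simpa using this

namespace IsFrame

variable {w u v : Idx l → ℝ}

theorem wb (F : IsFrame w u v) : form w (basePoint l) = 0 := by rw [form_comm, F.bw]
theorem ub (F : IsFrame w u v) : form u (basePoint l) = 0 := by rw [form_comm, F.bu]
theorem vb (F : IsFrame w u v) : form v (basePoint l) = 0 := by rw [form_comm, F.bv]
theorem uw (F : IsFrame w u v) : form u w = 0 := by rw [form_comm, F.wu]
theorem vw (F : IsFrame w u v) : form v w = 0 := by rw [form_comm, F.wv]
theorem vu (F : IsFrame w u v) : form v u = 2 := by rw [form_comm, F.uv]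

theorem form_mid_basePoint (F : IsFrame w u v)
    : form (basePoint l) ((1 / 2 : ℝ) • (u + v)) = 0 := by
  simp [F.bu, F.bv]

theorem form_mid_self (F : IsFrame w u v)
    : form ((1 / 2 : ℝ) • (u + v)) ((1 / 2 : ℝ) • (u + v)) = 1 := by
  simp [F.uu, F.vv, F.uv, F.vu]; norm_num

end IsFrame

/-- The exponential of a rotation in a positive plane through the base point. -/
theorem exp_smul_wedge_mulVec {a : Idx l → ℝ} (hb : form (basePoint l) a = 0)
    (ha : form a a = 1) (t : ℝ) (x : Idx l → ℝ) :
    (exp (t • wedge (basePoint l) a)).mat *ᵥ x = x +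
      Real.sin t • (form a x • basePoint l - form (basePoint l) x • a) -
      (1 - Real.cos t) • (form (basePoint l) x • basePoint l + form a x • a) := by
  have hb' : form a (basePoint l) = 0 := by rw [form_comm, hb]
  rw [exp_smul_mulVec_of_cube_eq_neg]
  · simp only [wedge_mulVec, form_sub_right, form_smul_right, hb, hb', ha, form_basePoint_self]
    module
  · simp only [wedge_mulVec, form_sub_right, form_smul_right, hb, hb', ha, form_basePoint_self]
    module

theorem exp_pi_smul_wedge_mulVec {a : Idx l → ℝ} (hb : form (basePoint l) a = 0)
    (ha : form a a = 1) (x : Idx l → ℝ) :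
    (exp (Real.pi • wedge (basePoint l) a)).mat *ᵥ x =
      x - (2 : ℝ) • (form (basePoint l) x • basePoint l + form a x • a) := by
  rw [exp_smul_wedge_mulVec hb ha, Real.sin_pi, Real.cos_pi]
  module

/-! ### The triple bracket on `𝒬` and `Ad(k_θ) = θ` -/

theorem lie_wedge_basePoint_wedge_basePoint {a b : Idx l → ℝ} (hb : form (basePoint l) b = 0)
    (ha : form (basePoint l) a = 0) :
    ⁅wedge (basePoint l) a, wedge (basePoint l) b⁆ = -wedge a b := by
  rw [lie_wedge, wedge_basePoint_mulVec ha]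
  refine so_ext fun x => ?_
  simp only [so_add_mulVec, so_neg_mulVec, wedge_mulVec, hb, form_sub_left, form_neg_left,
    form_smul_left]
  module

/-- The triple product of `𝒬` recovers `η` on `e₀^⊥`; since `θ` respects it, the induced map `onQ`
is tied to `η`. -/
theorem lie_lie_wedge_basePoint {a b c : Idx l → ℝ} (ha : form (basePoint l) a = 0)
    (hb : form (basePoint l) b = 0) :
    ⁅⁅wedge (basePoint l) a, wedge (basePoint l) b⁆, wedge (basePoint l) c⁆ =
      wedge (basePoint l) (form a c • b - form b c • a) := by
  have ha' : form a (basePoint l) = 0 := by rw [form_comm, ha]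
  have hb' : form b (basePoint l) = 0 := by rw [form_comm, hb]
  rw [lie_wedge_basePoint_wedge_basePoint hb ha, lie_wedge]
  refine so_ext fun x => ?_
  simp only [so_add_mulVec, so_neg_mulVec, wedge_mulVec, ha', hb', form_sub_left, form_neg_left,
    form_smul_left]
  module

namespace IwasawaData

variable (D : IwasawaData l)

/-- The action of `θ` on `𝒬`, identified with the orthogonal complement of the base point. -/
def onQ (v : Idx l → ℝ) : Idx l → ℝ :=
  -((D.θ (wedge (basePoint l) v)).1 *ᵥ basePoint l)

theorem form_basePoint_onQ (v : Idx l → ℝ) : form (basePoint l) (D.onQ v) = 0 := by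
  rw [onQ, form_neg_right, form_basePoint_mulVec, neg_zero]

theorem θ_wedge_basePoint {v : Idx l → ℝ} (hv : form (basePoint l) v = 0) :
    D.θ (wedge (basePoint l) v) = wedge (basePoint l) (D.onQ v) := by
  refine eq_wedge_of_sigma_eq_neg ?_
  rw [← D.θ_comm_σ, sigma_wedge_basePoint hv, map_neg]

theorem onQ_add (a b : Idx l → ℝ) : D.onQ (a + b) = D.onQ a + D.onQ b := by
  rw [onQ, wedge_add_right, map_add, so_add_mulVec, neg_add]; rfl

theorem onQ_smul (c : ℝ) (a : Idx l → ℝ) : D.onQ (c • a) = c • D.onQ a := by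
  rw [onQ, wedge_smul_right, map_smul, so_smul_mulVec, ← smul_neg]; rfl

theorem onQ_eq_of_θ_wedge {a b : Idx l → ℝ} (hb : form (basePoint l) b = 0)
    (h : D.θ (wedge (basePoint l) a) = wedge (basePoint l) b) : D.onQ a = b := by
  rw [onQ, h, wedge_basePoint_mulVec hb, neg_neg]

theorem onQ_onQ {v : Idx l → ℝ} (hv : form (basePoint l) v = 0) : D.onQ (D.onQ v) = v :=
  D.onQ_eq_of_θ_wedge hv (by rw [← D.θ_wedge_basePoint hv, D.cartan.involutive])

/-- Apply `θ` to `[[a, b], a]`: since `ε² = 1` the terms in `onQ b` cancel, and comparing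
coefficients of `a ≠ 0` remains. So `onQ` is self-adjoint when tested against an eigenvector. -/
theorem form_onQ_eigenvector {a b : Idx l → ℝ} {ε : ℝ} (ha : form (basePoint l) a = 0)
    (hb : form (basePoint l) b = 0) (hε : ε * ε = 1) (hTa : D.onQ a = ε • a) (ha0 : a ≠ 0) :
    form (D.onQ b) a = ε * form b a := by
  have h := congrArg D.θ (lie_lie_wedge_basePoint (c := a) ha hb)
  have hsum : form (basePoint l) (form a a • b - form b a • a) = 0 := by simp [ha, hb]
  rw [LieEquiv.map_lie, LieEquiv.map_lie, D.θ_wedge_basePoint ha, D.θ_wedge_basePoint hb,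
    D.θ_wedge_basePoint hsum,
    lie_lie_wedge_basePoint (D.form_basePoint_onQ a) (D.form_basePoint_onQ b)] at h
  have h' := wedge_basePoint_injective (by simp [D.form_basePoint_onQ])
    (D.form_basePoint_onQ _) h
  rw [sub_eq_add_neg (form a a • b), D.onQ_add, ← neg_smul, D.onQ_smul, D.onQ_smul, hTa] at h'
  simp only [form_smul_left, form_smul_right] at h'
  have h2 : (ε * form b a - (ε * ε) * form (D.onQ b) a) • a = 0 := by
    have h3 : ε * (ε * form a a) = form a a := by rw [← mul_assoc, hε, one_mul]
    rw [h3] at h'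
    linear_combination (norm := module) h'
  rcases smul_eq_zero.1 h2 with h3 | h3
  · rw [hε] at h3; linarith
  · exact absurd h3 ha0

end IwasawaData

namespace IwasawaData.HasFrame

variable {D : IwasawaData l} {w u v : Idx l → ℝ}

theorem onQ_w (F : D.HasFrame w u v) : D.onQ w = (-1 : ℝ) • w := by
  refine D.onQ_eq_of_θ_wedge (by simp [F.bw]) ?_
  rw [← F.J₂_eq, D.θ_J₂, wedge_smul_right, ← F.J₂_eq, neg_one_smul]

theorem onQ_mid (F : D.HasFrame w u v)
    : D.onQ ((1 / 2 : ℝ) • (u + v)) = (1 : ℝ) • (1 / 2 : ℝ) • (u + v) := by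
  have h1 : D.onQ u = v := D.onQ_eq_of_θ_wedge F.bv F.θ_wedge
  rw [D.onQ_smul, D.onQ_add, ← h1, D.onQ_onQ F.bu, add_comm, one_smul]

theorem onQ_eq_neg (F : D.HasFrame w u v) {x : Idx l → ℝ} (hx : form (basePoint l) x = 0)
    (hx' : form ((1 / 2 : ℝ) • (u + v)) x = 0) : D.onQ x = -x := by
  set a := (1 / 2 : ℝ) • (u + v) with ha
  have ha1 : form a a = 1 := F.form_mid_self
  have hba : form (basePoint l) a = 0 := F.form_mid_basePoint
  -- `y` is fixed by `onQ`. It is orthogonal to `a`, and to `w` because `w` has the opposite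
  -- eigenvalue; the aim is `y = 0`.
  set y := x + D.onQ x with hy
  have hby : form (basePoint l) y = 0 := by rw [hy, form_add_right, hx, D.form_basePoint_onQ, add_zero]
  have hTy : D.onQ y = y := by rw [hy, D.onQ_add, D.onQ_onQ hx, add_comm]
  have hw0 : w ≠ 0 := by
    rintro h0; have := F.ww; rw [h0] at this; simp at this
  have ha0 : a ≠ 0 := by
    rintro h0; rw [h0] at ha1; simp at ha1
  have hya : form a y = 0 := by
    have := D.form_onQ_eigenvector hba hx (by norm_num) F.onQ_mid ha0
    rw [hy, form_add_right, hx', form_comm, this, form_comm, hx']; norm_num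
  have hyw : form y w = 0 := by
    have := D.form_onQ_eigenvector F.bw hby (by norm_num) F.onQ_w hw0
    rw [hTy] at this; linarith
  have hwy : form w y = 0 := by rw [form_comm, hyw]
  have hwb := F.wb
  have hyb : form y (basePoint l) = 0 := by rw [form_comm, hby]
  suffices y = 0 by
    rw [hy, add_comm] at this
    exact eq_neg_of_add_eq_zero_left this
  by_contra hy0
  have hne : wedge (basePoint l) y ≠ 0 := by
    intro h0
    have := wedge_basePoint_mulVec hby
    rw [h0, so_zero_mulVec] at this
    exact hy0 (neg_eq_zero.1 this.symm)
  have hJne : D.J₂ ≠ 0 := by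
    intro h0
    have := wedge_basePoint_mulVec F.bw
    rw [← F.J₂_eq, h0, so_zero_mulVec] at this
    exact hw0 (neg_eq_zero.1 this.symm)
  have p1 := D.cartan.posDef _ hne
  have p2 := D.cartan.posDef _ hJne
  rw [D.θ_wedge_basePoint hby, hTy] at p1
  rw [D.θ_J₂, map_neg, neg_neg] at p2
  have b1 : ⁅D.J₂, wedge w y⁆ = -wedge (basePoint l) y := by
    rw [F.J₂_eq, lie_wedge]
    refine so_ext fun z => ?_
    simp only [so_add_mulVec, so_neg_mulVec, wedge_mulVec, F.ww, F.bw, hby, hwy, form_sub_left,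
      form_smul_left]
    module
  have b2 : ⁅wedge w y, wedge (basePoint l) y⁆ = form y y • D.J₂ := by
    rw [F.J₂_eq, lie_wedge]
    refine so_ext fun z => ?_
    simp only [so_add_mulVec, so_smul_mulVec, wedge_mulVec, hyb, hwb, hwy, form_sub_left,
      form_smul_left]
    module
  -- Invariance gives `-B(e₀ ∧ y, e₀ ∧ y) = η(y, y) B(J₂, J₂)`. The left side is positive since `e₀
  -- ∧ y ∈ 𝒦`, while `B(J₂, J₂) > 0` and `η(y, y) < 0`: a contradiction.
  have inv := LieModule.traceForm_apply_lie_apply ℝ (so l) (so l) D.J₂ (wedge w y)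
    (wedge (basePoint l) y)
  rw [b1, b2] at inv
  change killingForm ℝ (so l) _ _ = killingForm ℝ (so l) _ _ at inv
  rw [map_neg, map_smul, LinearMap.neg_apply, smul_eq_mul] at inv
  have hneg := form_self_neg hba ha1 hby hya hy0
  rw [inv] at p1
  exact absurd p1 (not_lt.2 (mul_nonpos_of_nonpos_of_nonneg hneg.le p2.le))

theorem kθ_mulVec (F : D.HasFrame w u v) (x : Idx l → ℝ) : D.kθ.mat *ᵥ x = x - (2 : ℝ) •
    (form (basePoint l) x • basePoint l +
      form ((1 / 2 : ℝ) • (u + v)) x • (1 / 2 : ℝ) • (u + v)) := by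
  rw [kθ, F.q₀_eq, exp_pi_smul_wedge_mulVec F.form_mid_basePoint F.form_mid_self]

theorem kθ_mulVec_basePoint (F : D.HasFrame w u v) : D.kθ.mat *ᵥ basePoint l = -basePoint l := by
  rw [F.kθ_mulVec, form_comm (_ • _), F.form_mid_basePoint, form_basePoint_self]
  module

theorem kθ_mul_self (F : D.HasFrame w u v) : D.kθ.mat * D.kθ.mat = 1 := by
  refine Matrix.ext_iff_mulVec.2 fun x => ?_
  have h1 := F.form_mid_basePoint
  have h2 := F.form_mid_self
  rw [← Matrix.mulVec_mulVec, Matrix.one_mulVec, F.kθ_mulVec, F.kθ_mulVec]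
  set a := (1 / 2 : ℝ) • (u + v)
  have h3 : form a (basePoint l) = 0 := by rw [form_comm, h1]
  simp only [form_sub_right, form_smul_right, form_add_right, h1, h2, h3, form_basePoint_self]
  module

theorem kθ_inv (F : D.HasFrame w u v) : (D.kθ⁻¹).mat = D.kθ.mat := by
  have : D.kθ⁻¹ = D.kθ := by
    rw [inv_eq_iff_mul_eq_one]
    exact Subtype.ext (Subtype.ext F.kθ_mul_self)
  rw [this]

theorem onQ_eq (F : D.HasFrame w u v) {x : Idx l → ℝ} (hx : form (basePoint l) x = 0) :
    D.onQ x = -(D.kθ.mat *ᵥ x) := by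
  have h1 := F.form_mid_basePoint
  have h2 := F.form_mid_self
  have h3 := F.onQ_mid
  rw [F.kθ_mulVec]
  have key := fun y => F.onQ_eq_neg (x := y)
  set a := (1 / 2 : ℝ) • (u + v)
  have h4 := key (x - form a x • a) (by simp [hx, h1]) (by simp [h2])
  have h5 : x = (x - form a x • a) + form a x • a := by module
  nth_rw 1 [h5]
  rw [D.onQ_add, D.onQ_smul, h4, h3, hx]
  module

/-- `k_θ` is self-adjoint for the form. -/
theorem form_kθ_left (F : D.HasFrame w u v)
    (x y : Idx l → ℝ) : form (D.kθ.mat *ᵥ x) y = form x (D.kθ.mat *ᵥ y) := by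
  have h := form_group D.kθ (D.kθ.mat *ᵥ x) y
  rw [Matrix.mulVec_mulVec, F.kθ_mul_self, Matrix.one_mulVec] at h
  exact h.symm

theorem θ_mulVec_of_sigma_eq_neg (F : D.HasFrame w u v)
    {X : so l} (hX : sigma l X = -X) (x : Idx l → ℝ) :
    (D.θ X).1 *ᵥ x = D.kθ.mat *ᵥ (X.1 *ᵥ (D.kθ.mat *ᵥ x)) := by
  have hX' := eq_wedge_of_sigma_eq_neg hX
  set y := -(X.1 *ᵥ basePoint l) with hy
  have hby : form (basePoint l) y = 0 := by rw [hy, form_neg_right, form_basePoint_mulVec, neg_zero]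
  rw [hX', D.θ_wedge_basePoint hby, F.onQ_eq hby]
  simp only [wedge_mulVec, ← F.form_kθ_left, Matrix.mulVec_sub, Matrix.mulVec_smul,
    F.kθ_mulVec_basePoint, form_neg_left]
  module

/-- For `X ∈ ℋ` one has `[X, e₀ ∧ y] = e₀ ∧ X y`, so `X` is determined by its action on `𝒬`, where
`θ` is already known. Both `X` and `θ X` kill `e₀`. -/
theorem θ_mulVec_of_sigma_eq (F : D.HasFrame w u v)
    {X : so l} (hX : sigma l X = X) (x : Idx l → ℝ) :
    (D.θ X).1 *ᵥ x = D.kθ.mat *ᵥ (X.1 *ᵥ (D.kθ.mat *ᵥ x)) := by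
  have hK (y : Idx l → ℝ) : D.kθ.mat *ᵥ (D.kθ.mat *ᵥ y) = y := by
    rw [Matrix.mulVec_mulVec, F.kθ_mul_self, Matrix.one_mulVec]
  have hθX : sigma l (D.θ X) = D.θ X := by rw [← D.θ_comm_σ, hX]
  have hb := mulVec_basePoint_of_sigma_eq hX
  have hb' := mulVec_basePoint_of_sigma_eq hθX
  have key (y : Idx l → ℝ) (hy : form (basePoint l) y = 0) :
      (D.θ X).1 *ᵥ (D.kθ.mat *ᵥ y) = D.kθ.mat *ᵥ (X.1 *ᵥ y) := by
    have hXy : form (basePoint l) (X.1 *ᵥ y) = 0 := by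
      rw [← neg_eq_zero, ← form_mulVec_left, hb, form_zero_left]
    have h0 (z) : wedge 0 z = (0 : so l) := so_ext fun x => by simp
    have h := congrArg D.θ (lie_wedge X (basePoint l) y)
    rw [hb, h0, zero_add, D.θ_wedge_basePoint hXy, LieEquiv.map_lie, D.θ_wedge_basePoint hy,
      lie_wedge, hb', h0, zero_add, F.onQ_eq hy, F.onQ_eq hXy] at h
    have h2 := wedge_basePoint_injective ?_ ?_ h
    · rw [Matrix.mulVec_neg] at h2
      exact neg_injective h2
    · rw [← neg_eq_zero, ← form_mulVec_left, hb', form_zero_left]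
    · rw [← F.onQ_eq hXy, D.form_basePoint_onQ]
  have hx : x = form (basePoint l) x • basePoint l +
    D.kθ.mat *ᵥ (D.kθ.mat *ᵥ (x - form (basePoint l) x • basePoint l)) := by rw [hK]; module
  have hy : form (basePoint l) (D.kθ.mat *ᵥ (x - form (basePoint l) x • basePoint l)) = 0 := by
    rw [← F.form_kθ_left, F.kθ_mulVec_basePoint]; simp
  conv_lhs => rw [hx]
  rw [Matrix.mulVec_add, key _ hy]
  simp only [Matrix.mulVec_sub, Matrix.mulVec_smul, hb', F.kθ_mulVec_basePoint, Matrix.mulVec_neg,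
    hb]
  simp

theorem θ_eq_conj (F : D.HasFrame w u v) (X : so l) :
    ((D.θ X : so l) : Matrix (Idx l) (Idx l) ℝ) = D.kθ.mat * X.1 * (D.kθ⁻¹).mat := by
  refine Matrix.ext_iff_mulVec.2 fun x => ?_
  rw [F.kθ_inv, ← Matrix.mulVec_mulVec, ← Matrix.mulVec_mulVec]
  have h1 := F.θ_mulVec_of_sigma_eq (X := (1 / 2 : ℝ) • (X + sigma l X))
    (by rw [map_smul, map_add, sigma_sigma, add_comm]) x
  have h2 := F.θ_mulVec_of_sigma_eq_neg (X := (1 / 2 : ℝ) • (X - sigma l X))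
    (by rw [map_smul, map_sub, sigma_sigma]; module) x
  have h3 : X = (1 / 2 : ℝ) • (X + sigma l X) + (1 / 2 : ℝ) • (X - sigma l X) := by module
  rw [h3, map_add, so_add_mulVec, so_add_mulVec, h1, h2, Matrix.mulVec_add]

end IwasawaData.HasFrame

/-! ### `AdS_l` as part of a quadric -/

/-- The embedding `[g] ↦ g e₀` of `AdS_l` in `ℝ^{2,l-1}`. -/
def coord : Space l → Idx l → ℝ :=
  Quotient.lift (fun g : G l => g.mat *ᵥ basePoint l) (by
    intro a b hab
    have h : a⁻¹ * b ∈ H l := QuotientGroup.leftRel_apply.1 hab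
    have h' : (a⁻¹ * b).mat *ᵥ basePoint l = basePoint l := h
    have hb : b.mat = a.mat * (a⁻¹ * b).mat := congrArg G.mat (mul_inv_cancel_left a b).symm
    change a.mat *ᵥ _ = b.mat *ᵥ _
    rw [hb, ← Matrix.mulVec_mulVec, h'])

theorem coord_proj (g : G l) : coord (proj g) = g.mat *ᵥ basePoint l := rfl

theorem mul_mulVec (g h : G l) (x : Idx l → ℝ) : (g * h).mat *ᵥ x = g.mat *ᵥ (h.mat *ᵥ x) :=
  (Matrix.mulVec_mulVec x g.mat h.mat).symm

theorem inv_mulVec_mulVec (g : G l) (x : Idx l → ℝ) : g⁻¹.mat *ᵥ (g.mat *ᵥ x) = x := by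
  rw [← mul_mulVec, inv_mul_cancel]; exact Matrix.one_mulVec x

theorem coord_smul (g : G l) (ξ : Space l) : coord (g • ξ) = g.mat *ᵥ coord ξ := by
  induction ξ using QuotientGroup.induction_on with
  | H h => exact mul_mulVec g h _

theorem coord_injective : Function.Injective (coord (l := l)) := by
  intro ξ ζ h
  induction ξ using QuotientGroup.induction_on with
  | H a =>
    induction ζ using QuotientGroup.induction_on with
    | H b =>
      change a.mat *ᵥ _ = b.mat *ᵥ _ at h
      refine QuotientGroup.eq.2 ?_
      change (a⁻¹ * b).mat *ᵥ _ = _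
      rw [mul_mulVec, ← h, inv_mulVec_mulVec]

theorem form_coord (ξ : Space l) : form (coord ξ) (coord ξ) = 1 := by
  induction ξ using QuotientGroup.induction_on with
  | H a => exact (form_group a _ _).trans form_basePoint_self

theorem continuous_coord : Continuous (coord (l := l)) := by
  refine continuous_quot_lift _ ?_
  have h1 : Continuous fun g : G l => (g : Matrix.SpecialLinearGroup (Idx l) ℝ) :=
    continuous_subtype_val
  have h2 : Continuous fun g : Matrix.SpecialLinearGroup (Idx l) ℝ =>
      (g : Matrix (Idx l) (Idx l) ℝ) := continuous_subtype_val
  exact (h2.comp h1).matrix_mulVec continuous_const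

theorem continuous_form_coord (a : Idx l → ℝ) : Continuous fun ξ : Space l => form a (coord ξ) :=
  continuous_const.dotProduct (continuous_const.matrix_mulVec continuous_coord)

theorem continuous_exp_smul (X : so l) : Continuous fun t : ℝ => exp (t • X) := by
  refine Continuous.subtype_mk (Continuous.subtype_mk ?_ _) _
  let _ : NormedRing (Matrix (Idx l) (Idx l) ℝ) := Matrix.linftyOpNormedRing
  let _ : NormedAlgebra ℝ (Matrix (Idx l) (Idx l) ℝ) := Matrix.linftyOpNormedAlgebra
  let _ : NormedAlgebra ℚ (Matrix (Idx l) (Idx l) ℝ) := NormedAlgebra.restrictScalars ℚ ℝ _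
  exact (NormedSpace.exp_continuous (𝔸 := Matrix (Idx l) (Idx l) ℝ)).comp
    (continuous_id.smul (continuous_const (y := X.1)))

/-! ### The flag preserved by `AN` -/

/-- The elements of `G` that preserve the flag spanned by `u` and `n`, with positive diagonal
entries. -/
def flagSubgroup (u n : Idx l → ℝ) : Subgroup (G l) where
  carrier := {g | ∃ a b c : ℝ, 0 < a ∧ 0 < b ∧ g.mat *ᵥ u = a • u ∧ g.mat *ᵥ n = b • n + c • u}
  one_mem' := ⟨1, 1, 0, one_pos, one_pos,
    (Matrix.one_mulVec u).trans (by simp), (Matrix.one_mulVec n).trans (by simp)⟩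
  mul_mem' := by
    rintro g h ⟨a, b, c, ha, hb, hu, hn⟩ ⟨a', b', c', ha', hb', hu', hn'⟩
    refine ⟨a' * a, b' * b, b' * c + c' * a, mul_pos ha' ha, mul_pos hb' hb, ?_, ?_⟩
    · rw [mul_mulVec, hu', Matrix.mulVec_smul, hu, smul_smul]
    · rw [mul_mulVec, hn', Matrix.mulVec_add, Matrix.mulVec_smul, Matrix.mulVec_smul, hu, hn]
      module
  inv_mem' := by
    rintro g ⟨a, b, c, ha, hb, hu, hn⟩
    have h1 : g⁻¹.mat *ᵥ u = a⁻¹ • u := by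
      have h := inv_mulVec_mulVec g u
      rw [hu, Matrix.mulVec_smul] at h
      rw [eq_inv_smul_iff₀ ha.ne', h]
    refine ⟨a⁻¹, b⁻¹, -(b⁻¹ * c * a⁻¹), inv_pos.2 ha, inv_pos.2 hb, h1, ?_⟩
    have h := inv_mulVec_mulVec g n
    rw [hn, Matrix.mulVec_add, Matrix.mulVec_smul, Matrix.mulVec_smul, h1] at h
    have h2 : b • g⁻¹.mat *ᵥ n = n - (c * a⁻¹) • u := by
      linear_combination (norm := module) h
    rw [← eq_inv_smul_iff₀ hb.ne'] at h2
    rw [h2]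
    module

theorem lie_mulVec_of_weight {J X : so l} {x : Idx l → ℝ} {α p : ℝ} (h : ⁅J, X⁆ = α • X)
    (hx : J.1 *ᵥ x = p • x) : J.1 *ᵥ (X.1 *ᵥ x) = (α + p) • (X.1 *ᵥ x) := by
  have h1 := congrArg (fun Z : so l => Z.1 *ᵥ x) h
  simp only [lie_mulVec, so_smul_mulVec, hx, Matrix.mulVec_smul] at h1
  linear_combination (norm := module) h1

namespace IwasawaData.HasFrame

variable {D : IwasawaData l} {w u v : Idx l → ℝ}

theorem J₁_mulVec (F : D.HasFrame w u v) (x : Idx l → ℝ) :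
    D.J₁.1 *ᵥ x = (1 / 2 : ℝ) • (form v x • u - form u x • v) := by
  rw [F.J₁_eq, so_smul_mulVec, wedge_mulVec]

theorem J₂_mulVec (F : D.HasFrame w u v) (x : Idx l → ℝ) :
    D.J₂.1 *ᵥ x = form w x • basePoint l - form (basePoint l) x • w := by
  rw [F.J₂_eq, wedge_mulVec]

/-- On the vector representation `J₁³ = J₁`, `J₂³ = J₂` and `J₁ J₂ = 0`, so the only possible
weights are `(±1, 0)`, `(0, ±1)` and `(0, 0)`. -/
theorem eq_zero_of_weight (F : D.HasFrame w u v)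
    {x : Idx l → ℝ} {p q : ℝ} (h1 : D.J₁.1 *ᵥ x = p • x)
    (h2 : D.J₂.1 *ᵥ x = q • x) (h : p * q ≠ 0 ∨ p ^ 3 ≠ p ∨ q ^ 3 ≠ q) : x = 0 := by
  have c1 : D.J₁.1 *ᵥ (D.J₁.1 *ᵥ (D.J₁.1 *ᵥ x)) = D.J₁.1 *ᵥ x := by
    simp only [F.J₁_mulVec, form_smul_right, form_sub_right, F.uu, F.vv, F.uv, F.vu]
    module
  have c2 : D.J₂.1 *ᵥ (D.J₂.1 *ᵥ (D.J₂.1 *ᵥ x)) = D.J₂.1 *ᵥ x := by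
    simp only [F.J₂_mulVec, form_smul_right, form_sub_right, F.ww, F.bw, F.wb, form_basePoint_self]
    module
  have c3 : D.J₁.1 *ᵥ (D.J₂.1 *ᵥ x) = 0 := by
    simp only [F.J₁_mulVec, F.J₂_mulVec, form_smul_right, form_sub_right, F.uw, F.vw, F.ub, F.vb]
    module
  simp only [h1, h2, Matrix.mulVec_smul, smul_smul] at c1 c2 c3
  by_contra hx
  rcases h with h | h | h
  · rcases smul_eq_zero.1 c3 with h' | h'
    · exact h (by linarith)
    · exact hx h'
  · have := smul_left_injective ℝ hx c1
    exact h (by linear_combination this)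
  · have := smul_left_injective ℝ hx c2
    exact h (by linear_combination this)

theorem J₁_u (F : D.HasFrame w u v) : D.J₁.1 *ᵥ u = (1 : ℝ) • u := by
  rw [F.J₁_mulVec, F.uu, F.vu]; module

theorem J₂_u (F : D.HasFrame w u v) : D.J₂.1 *ᵥ u = (0 : ℝ) • u := by
  rw [F.J₂_mulVec, F.wu, F.bu]; module

theorem J₁_n (F : D.HasFrame w u v)
    : D.J₁.1 *ᵥ (basePoint l - w) = (0 : ℝ) • (basePoint l - w) := by
  simp only [F.J₁_mulVec, form_sub_right, F.ub, F.uw, F.vb, F.vw]; module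

theorem J₂_n (F : D.HasFrame w u v)
    : D.J₂.1 *ᵥ (basePoint l - w) = (1 : ℝ) • (basePoint l - w) := by
  simp only [F.J₂_mulVec, form_sub_right, F.bw, F.wb, F.ww, form_basePoint_self]; module

theorem mulVec_of_mem_𝒩 (F : D.HasFrame w u v) {X : so l} (hX : X ∈ D.𝒩) :
    X.1 *ᵥ u = 0 ∧ ∃ c : ℝ, X.1 *ᵥ (basePoint l - w) = c • u := by
  rw [𝒩] at hX
  obtain ⟨Y, hY, X₄, h₄, rfl⟩ := Submodule.mem_sup.1 hX
  obtain ⟨Z, hZ, X₃, h₃, rfl⟩ := Submodule.mem_sup.1 hY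
  obtain ⟨X₁, h₁, X₂, h₂, rfl⟩ := Submodule.mem_sup.1 hZ
  have wt {α β : ℝ} {Y : so l} (h : Y ∈ rootSpace D.J₁ D.J₂ α β) :
      (D.J₁.1 *ᵥ (Y.1 *ᵥ u) = (α + 1) • (Y.1 *ᵥ u) ∧
        D.J₂.1 *ᵥ (Y.1 *ᵥ u) = (β + 0) • (Y.1 *ᵥ u)) ∧
      D.J₁.1 *ᵥ (Y.1 *ᵥ (basePoint l - w)) = (α + 0) • (Y.1 *ᵥ (basePoint l - w)) ∧
        D.J₂.1 *ᵥ (Y.1 *ᵥ (basePoint l - w)) = (β + 1) • (Y.1 *ᵥ (basePoint l - w)) :=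
    ⟨⟨lie_mulVec_of_weight h.1 F.J₁_u, lie_mulVec_of_weight h.2 F.J₂_u⟩,
      lie_mulVec_of_weight h.1 F.J₁_n, lie_mulVec_of_weight h.2 F.J₂_n⟩
  have a1 := F.eq_zero_of_weight (wt h₁).1.1 (wt h₁).1.2 (by norm_num)
  have a2 := F.eq_zero_of_weight (wt h₂).1.1 (wt h₂).1.2 (by norm_num)
  have a3 := F.eq_zero_of_weight (wt h₃).1.1 (wt h₃).1.2 (by norm_num)
  have a4 := F.eq_zero_of_weight (wt h₄).1.1 (wt h₄).1.2 (by norm_num)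
  have b1 := F.eq_zero_of_weight (wt h₁).2.1 (wt h₁).2.2 (by norm_num)
  have b3 := F.eq_zero_of_weight (wt h₃).2.1 (wt h₃).2.2 (by norm_num)
  have b4 := F.eq_zero_of_weight (wt h₄).2.1 (wt h₄).2.2 (by norm_num)
  -- Only `𝒢_{+-}` can move `n`: it sends `n`, of weight `(0, 1)`, to weight `(1, 0)`, which is the
  -- line of `u`.
  have b2 := (wt h₂).2.1
  rw [F.J₁_mulVec] at b2
  set y := X₂.1 *ᵥ (basePoint l - w)
  have hyu : form u y = 0 := by
    have := congrArg (form u) b2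
    simp only [form_smul_right, form_sub_right, F.uu, F.uv] at this
    linarith
  refine ⟨by simp only [so_add_mulVec, a1, a2, a3, a4, add_zero], 1 / 2 * form v y, ?_⟩
  simp only [so_add_mulVec, b1, b3, b4, add_zero, zero_add]
  rw [hyu] at b2
  change y = _
  linear_combination (norm := module) -b2

theorem R_le_flagSubgroup (F : D.HasFrame w u v) : D.R ≤ flagSubgroup u (basePoint l - w) := by
  refine sup_le ((Subgroup.closure_le _).2 ?_) ((Subgroup.closure_le _).2 ?_)
  · rintro _ ⟨X, hX, rfl⟩
    obtain ⟨a, b, rfl⟩ := Submodule.mem_span_pair.1 hX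
    refine ⟨Real.exp a, Real.exp b, 0, Real.exp_pos _, Real.exp_pos _,
      exp_mulVec_of_eigenvector ?_, ?_⟩
    · simp only [so_add_mulVec, so_smul_mulVec, F.J₁_u, F.J₂_u]; module
    · rw [exp_mulVec_of_eigenvector (a := b), zero_smul, add_zero]
      simp only [so_add_mulVec, so_smul_mulVec, F.J₁_n, F.J₂_n]; module
  · rintro _ ⟨X, hX, rfl⟩
    obtain ⟨hu, c, hn⟩ := F.mulVec_of_mem_𝒩 hX
    refine ⟨1, 1, c, one_pos, one_pos, ?_, ?_⟩
    · rw [exp_mulVec_of_eigenvector (a := 0) (by simp [hu]), Real.exp_zero]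
    · have h3 : X.1 *ᵥ (X.1 *ᵥ (basePoint l - w)) = 0 := by
        rw [hn, Matrix.mulVec_smul, hu, smul_zero]
      rw [exp_mulVec_of_cube_eq_zero (by rw [h3, Matrix.mulVec_zero]), h3, hn]
      module

/-! ### Elements of `A` and `N`, and normal forms of points -/

theorem exp_J₁_mem (t : ℝ) : exp (t • D.J₁) ∈ D.A :=
  Subgroup.subset_closure ⟨_, Submodule.smul_mem _ _ (Submodule.subset_span (by simp)), rfl⟩

theorem exp_J₂_mem (t : ℝ) : exp (t • D.J₂) ∈ D.A :=
  Subgroup.subset_closure ⟨_, Submodule.smul_mem _ _ (Submodule.subset_span (by simp)), rfl⟩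

theorem exp_mem_N {X : so l} (hX : X ∈ D.𝒩) : exp X ∈ D.N :=
  Subgroup.subset_closure ⟨_, hX, rfl⟩

theorem wedge_mem_rootSpace {x y : Idx l → ℝ} {p q p' q' : ℝ} (h1 : D.J₁.1 *ᵥ x = p • x)
    (h2 : D.J₂.1 *ᵥ x = q • x) (h1' : D.J₁.1 *ᵥ y = p' • y) (h2' : D.J₂.1 *ᵥ y = q' • y) :
    wedge x y ∈ rootSpace D.J₁ D.J₂ (p + p') (q + q') := by
  constructor
  · rw [lie_wedge, h1, h1', wedge_smul_right, wedge_smul_left, add_smul]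
  · rw [lie_wedge, h2, h2', wedge_smul_right, wedge_smul_left, add_smul]

theorem wedge_n_mem_𝒩 (F : D.HasFrame w u v)
    {z : Idx l → ℝ} (hb : form (basePoint l) z = 0) (hw : form w z = 0)
    (hu : form u z = 0) (hv : form v z = 0) : wedge (basePoint l - w) z ∈ D.𝒩 := by
  refine Submodule.mem_sup_right ?_
  have := wedge_mem_rootSpace F.J₁_n F.J₂_n (y := z) (p' := 0) (q' := 0)
    (by rw [F.J₁_mulVec, hu, hv]; module) (by rw [F.J₂_mulVec, hb, hw]; module)
  simpa using this

theorem wedge_u_mem_𝒩 (F : D.HasFrame w u v)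
    {y : Idx l → ℝ} (hu : form u y = 0) (hv : form v y = 0) :
    wedge u y ∈ D.𝒩 := by
  set b := form (basePoint l) y with hb
  set c := form w y with hc
  set z := y - b • basePoint l + c • w with hz
  -- Weight decomposition of `y`: wedging with `u` sends the three summands to `𝒢_{+0}`, `𝒢_{++}`
  -- and `𝒢_{+-}`.
  have hy : y = z + ((b + c) / 2) • (basePoint l - w) + ((b - c) / 2) • (basePoint l + w) := by
    rw [hz]; module
  have m1 : wedge u (basePoint l - w) ∈ D.𝒩 := by
    refine Submodule.mem_sup_left (Submodule.mem_sup_left (Submodule.mem_sup_left ?_))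
    simpa using wedge_mem_rootSpace F.J₁_u F.J₂_u F.J₁_n F.J₂_n
  have m2 : wedge u (basePoint l + w) ∈ D.𝒩 := by
    refine Submodule.mem_sup_left (Submodule.mem_sup_left (Submodule.mem_sup_right ?_))
    have := wedge_mem_rootSpace F.J₁_u F.J₂_u (y := basePoint l + w) (p' := 0) (q' := -1)
      (by simp only [F.J₁_mulVec, form_add_right, F.ub, F.uw, F.vb, F.vw]; module)
      (by simp only [F.J₂_mulVec, form_add_right, F.bw, F.wb, F.ww, form_basePoint_self]; module)
    simpa using this
  have m3 : wedge u z ∈ D.𝒩 := by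
    refine Submodule.mem_sup_left (Submodule.mem_sup_right ?_)
    have := wedge_mem_rootSpace F.J₁_u F.J₂_u (y := z) (p' := 0) (q' := 0)
      (by simp only [hz, F.J₁_mulVec, form_add_right, form_sub_right, form_smul_right, F.ub, F.uw,
            F.vb, F.vw, hu, hv]; module)
      (by simp only [hz, F.J₂_mulVec, form_add_right, form_sub_right, form_smul_right, F.bw, F.wb,
            F.ww, form_basePoint_self, ← hb, ← hc]; module)
    simpa using this
  rw [hy, wedge_add_right, wedge_add_right, wedge_smul_right, wedge_smul_right]
  exact D.𝒩.add_mem (D.𝒩.add_mem m3 (D.𝒩.smul_mem _ m1)) (D.𝒩.smul_mem _ m2)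

/-- An element of `A` contracts the pairing of a weight vector with `x` to a sign. -/
theorem exists_form_eq_sign {J : so l} {n x : Idx l → ℝ} {ε : ℝ} (hε : ε = 1 ∨ ε = -1)
    (hJ : J.1 *ᵥ n = (1 : ℝ) • n) (hx : 0 < ε * form n x) :
    ∃ t : ℝ, form n ((exp (t • J)).mat *ᵥ x) = ε := by
  -- `exp(tJ)` scales `n` by `e^t`, so by invariance of `η` it scales the pairing of `n` with `x` by
  -- `e^{-t}`.
  refine ⟨Real.log (ε * form n x), ?_⟩
  have h := form_group (exp (Real.log (ε * form n x) • J)) n x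
  rw [exp_smul_mulVec_of_eigenvector hJ, mul_one, Real.exp_log hx, form_smul_left] at h
  have hn : form n x ≠ 0 := by
    rintro h0; rw [h0, mul_zero] at hx; exact lt_irrefl _ hx
  have hε2 : ε * ε = 1 := by rcases hε with rfl | rfl <;> norm_num
  have h2 : form n x * (ε * form n ((exp (Real.log (ε * form n x) • J)).mat *ᵥ x)) =
    form n x * 1 := by linear_combination h
  have h3 := mul_left_cancel₀ hn h2
  linear_combination ε * h3 - form n ((exp (Real.log (ε * form n x) • J)).mat *ᵥ x) * hε2

theorem exists_mulVec_eq_mid (F : D.HasFrame w u v)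
    {x : Idx l → ℝ} {ε : ℝ} (hε : ε = 1 ∨ ε = -1) (hxx : form x x = 1)
    (hx : 0 < ε * form u x) :
    ∃ a ∈ D.A, ∃ n ∈ D.N, n.mat *ᵥ (a.mat *ᵥ x) = ε • (1 / 2 : ℝ) • (u + v) := by
  obtain ⟨t, ht⟩ := exists_form_eq_sign hε F.J₁_u hx
  refine ⟨_, exp_J₁_mem t, ?_⟩
  have hyy := form_group (exp (t • D.J₁)) x x
  rw [hxx] at hyy
  set x' := (exp (t • D.J₁)).mat *ᵥ x
  have hx'u : form x' u = ε := by rw [form_comm, ht]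
  have hx'v : form x' v = form v x' := form_comm _ _
  have hε2 : ε * ε = 1 := by rcases hε with rfl | rfl <;> norm_num
  set b := form v x'
  -- Up to the factor `ε`, the component of `x'` orthogonal to `u` and `v`. Since `η(u, x') = ε`,
  -- `exp(u ∧ y)` cancels it.
  set y := ε • (x' - (1 / 2 * b) • u - (1 / 2 * ε) • v) with hy
  have huy : form u y = 0 := by
    simp only [hy, form_smul_right, form_sub_right, F.uu, F.uv, ht]; ring
  have hvy : form v y = 0 := by
    simp only [hy, form_smul_right, form_sub_right, F.vv, F.vu]
    change ε * (b - _ - _) = 0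
    ring
  have hyu : form y u = 0 := by rw [form_comm, huy]
  refine ⟨_, exp_mem_N (F.wedge_u_mem_𝒩 huy hvy), ?_⟩
  have hg := form_group (exp (wedge u y)) x' x'
  have h2 : (exp (wedge u y)).mat *ᵥ x' =
      (1 / 2 * ε) • v + (1 / 2 * b + form y x' - 1 / 2 * ε * form y y) • u := by
    rw [exp_mulVec_of_cube_eq_zero]
    · simp only [wedge_mulVec, form_sub_right, form_smul_right, huy, hyu, F.uu, ht]
      have e : ε • y = x' - (1 / 2 * b) • u - (1 / 2 * ε) • v := by
        rw [hy, smul_smul, hε2, one_smul]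
      linear_combination (norm := module) -e
    · simp only [wedge_mulVec, form_sub_right, form_smul_right, huy, hyu, F.uu, ht]
      module
  rw [h2] at hg ⊢
  set κ := 1 / 2 * b + form y x' - 1 / 2 * ε * form y y
  simp only [form_add_left, form_add_right, form_smul_left, form_smul_right, F.uu, F.vv, F.uv,
    F.vu, hyy] at hg
  -- The coefficient of `u` need not be computed: the square of the vector is still `1`, which reads
  -- `2 ε κ = 1`.
  have hκ : κ = 1 / 2 * ε := by linear_combination 1 / 2 * ε * hg - κ * hε2
  rw [hκ]
  module

theorem exists_mulVec_eq_basePoint (F : D.HasFrame w u v)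
    {x : Idx l → ℝ} {ε : ℝ} (hε : ε = 1 ∨ ε = -1)
    (hxx : form x x = 1) (hxu : form u x = 0) (hx : 0 < ε * form (basePoint l - w) x) :
    ∃ a ∈ D.A, ∃ n ∈ D.N, n.mat *ᵥ (a.mat *ᵥ x) = ε • basePoint l := by
  obtain ⟨t, ht⟩ := exists_form_eq_sign hε F.J₂_n hx
  refine ⟨_, exp_J₂_mem t, ?_⟩
  have hyy := form_group (exp (t • D.J₂)) x x
  have hux := form_group (exp (t • D.J₂)) u x
  rw [exp_smul_mulVec_of_eigenvector F.J₂_u, mul_zero, Real.exp_zero, one_smul, hxu] at hux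
  rw [hxx] at hyy
  set x' := (exp (t • D.J₂)).mat *ᵥ x
  have hε2 : ε * ε = 1 := by rcases hε with rfl | rfl <;> norm_num
  set b := 1 / 2 * form v x' with hb
  set c := form w x' with hc
  have hbx : form (basePoint l) x' = ε + c := by
    rw [form_sub_left] at ht; linarith
  set n := basePoint l - w with hn
  have huy : form u ((-(ε * b)) • n) = 0 := by
    simp only [hn, form_smul_right, form_sub_right, F.ub, F.uw]; ring
  have hvy : form v ((-(ε * b)) • n) = 0 := by
    simp only [hn, form_smul_right, form_sub_right, F.vb, F.vw]; ring
  have hun : form u n = 0 := by simp [hn, F.ub, F.uw]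
  have hnu : form n u = 0 := by rw [form_comm, hun]
  have hvn : form v n = 0 := by simp [hn, F.vb, F.vw]
  have hnn : form n n = 0 := by simp [hn, F.wb, F.bw, F.ww]
  -- First unipotent move: `u ∧ n` removes the component along `u`, using `η(n, x') = ε` and `η(u,
  -- x') = 0`.
  have h1 : (exp (wedge u ((-(ε * b)) • n))).mat *ᵥ x' = x' - b • u := by
    rw [exp_mulVec_of_cube_eq_zero]
    · simp only [wedge_mulVec, form_sub_right, form_smul_right, form_smul_left, hun, hnu, F.uu, hux,
        ht]
      have : -(ε * b) * ε = -b := by linear_combination -b * hε2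
      rw [this]
      module
    · simp only [wedge_mulVec, form_sub_right, form_smul_right, form_smul_left, hun, hnu, F.uu, hux,
        ht]
      module
  -- The component orthogonal to `e₀`, `w`, `u`, `v`, removed by the second move `exp(n ∧ ε z₀)`.
  -- The subtracted terms write the `⟨e₀, w⟩`-part in the null basis `e₀ ± w`; the final coefficient
  -- of `n` again follows from the square being `1`.
  set z₀ := x' - b • u - (1 / 2 * ε) • (basePoint l + w) - (1 / 2 * ε + c) • n with hz₀
  have z1 : form (basePoint l) z₀ = 0 := by
    simp only [hz₀, hn, form_sub_right, form_add_right, form_smul_right, F.bw, F.bu, hbx,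
      form_basePoint_self]; ring
  have z2 : form w z₀ = 0 := by
    simp only [hz₀, hn, form_sub_right, form_add_right, form_smul_right, F.wb, F.wu, F.ww, ← hc]
    ring
  have z3 : form u z₀ = 0 := by
    simp only [hz₀, hn, form_sub_right, form_add_right, form_smul_right, F.ub, F.uu, F.uw, hux]
    ring
  have z4 : form v z₀ = 0 := by
    simp only [hz₀, hn, form_sub_right, form_add_right, form_smul_right, F.vb, F.vu, F.vw]
    rw [hb]; ring
  have z5 : form n z₀ = 0 := by rw [hn, form_sub_left, z1, z2, sub_zero]
  have z6 : form z₀ n = 0 := by rw [form_comm, z5]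
  have hmem : wedge n (ε • z₀) ∈ D.𝒩 := by
    rw [wedge_smul_right]
    exact D.𝒩.smul_mem _ (F.wedge_n_mem_𝒩 z1 z2 z3 z4)
  refine ⟨exp (wedge n (ε • z₀)) * exp (wedge u ((-(ε * b)) • n)),
    D.N.mul_mem (exp_mem_N hmem) (exp_mem_N (F.wedge_u_mem_𝒩 huy hvy)), ?_⟩
  have hg := form_group (exp (wedge n (ε • z₀)) * exp (wedge u ((-(ε * b)) • n))) x' x'
  have h2 : ∃ κ : ℝ, (exp (wedge n (ε • z₀)) * exp (wedge u ((-(ε * b)) • n))).mat *ᵥ x' =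
      (1 / 2 * ε) • (basePoint l + w) + κ • n := by
    rw [mul_mulVec, h1, exp_mulVec_of_cube_eq_zero]
    · simp only [wedge_mulVec, form_sub_right, form_smul_right, form_smul_left, z5, z6, hnn, hnu, ht]
      refine ⟨1 / 2 * ε + c + ε * (form z₀ x' - b * form z₀ u) -
        1 / 2 * (ε * ε) * (ε * form z₀ z₀), ?_⟩
      have e : (ε * ε) • z₀ = x' - b • u - (1 / 2 * ε) • (basePoint l + w) -
          (1 / 2 * ε + c) • n := by rw [hε2, one_smul]
      linear_combination (norm := module) -e
    · simp only [wedge_mulVec, form_sub_right, form_smul_right, form_smul_left, z5, z6, hnn, hnu, ht]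
      module
  obtain ⟨κ, hκ⟩ := h2
  rw [hκ] at hg ⊢
  simp only [hn, form_add_left, form_add_right, form_sub_left, form_sub_right, form_smul_left,
    form_smul_right, F.bw, F.wb, F.ww, form_basePoint_self, hyy] at hg
  have hκ' : κ = 1 / 2 * ε := by linear_combination 1 / 2 * ε * hg - κ * hε2
  rw [hκ', hn]
  module

/-- Otherwise `x` is orthogonal to the isotropic plane `⟨u, n⟩`. Subtracting an element of that
plane leaves the square at `1` but makes `x` orthogonal to the positive plane `⟨e₀, ½(u + v)⟩`,
where `η` is negative definite. -/
theorem form_n_ne_zero (F : D.HasFrame w u v)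
    {x : Idx l → ℝ} (hxx : form x x = 1) (hxu : form u x = 0) :
    form (basePoint l - w) x ≠ 0 := by
  intro h
  have hw : form w x = form (basePoint l) x := by rw [form_sub_left] at h; linarith
  have hxu' : form x u = 0 := by rw [form_comm, hxu]
  have hxb : form x (basePoint l) = form (basePoint l) x := form_comm _ _
  have hxw : form x w = form (basePoint l) x := by rw [form_comm, hw]
  set d := form (basePoint l) x
  set z := x - (1 / 2 * form v x) • u - d • (basePoint l - w) with hz
  have z1 : form (basePoint l) z = 0 := by
    simp only [hz, form_sub_right, form_smul_right, form_basePoint_self, F.bw, F.bu]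
    change d - _ - _ = 0
    ring
  have z2 : form ((1 / 2 : ℝ) • (u + v)) z = 0 := by
    simp only [hz, form_sub_right, form_smul_right, form_smul_left, form_add_left, F.uu, F.ub,
      F.uw, F.vu, F.vb, F.vw, hxu]
    ring
  have z3 : form z z = 1 := by
    simp only [hz, form_sub_right, form_smul_right, form_sub_left, form_smul_left, F.uu, F.ub,
      F.uw, F.bu, F.wu, F.bw, F.wb, F.ww, form_basePoint_self, hxx, hxu, hxu', hxb, hxw, hw]
    change 1 - _ - d * (d - d) - _ - d * (d - _ - _ - _) = 1
    ring
  have := form_self_neg F.form_mid_basePoint F.form_mid_self z1 z2 (by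
    rintro h0; rw [h0] at z3; simp at z3)
  linarith

end IwasawaData.HasFrame

/-! ### The four orbits of `AN` -/

/-- The points of `AdS_l` orthogonal to `u` whose pairing with `n` has the sign of `ε`. -/
def nullSlice (u n : Idx l → ℝ) (ε : ℝ) : Set (Space l) :=
  {ξ | form u (coord ξ) = 0 ∧ 0 < ε * form n (coord ξ)}

/-- The points of `AdS_l` whose pairing with `u` has the sign of `ε`. -/
def halfSpace (u : Idx l → ℝ) (ε : ℝ) : Set (Space l) := {ξ | 0 < ε * form u (coord ξ)}

theorem isOpen_halfSpace (u : Idx l → ℝ) (ε : ℝ) : IsOpen (halfSpace u ε) :=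
  isOpen_lt continuous_const (continuous_const.mul (continuous_form_coord u))

theorem smul_mem_halfSpace {u n : Idx l → ℝ} {ε : ℝ} {g : G l} (hg : g ∈ flagSubgroup u n)
    {ξ : Space l} (hξ : ξ ∈ halfSpace u ε) : g • ξ ∈ halfSpace u ε := by
  obtain ⟨a, b, c, ha, hb, hu, hn⟩ := hg
  have h := form_group g u (coord ξ)
  change 0 < ε * form u (coord (g • ξ))
  rw [hu, form_smul_left, ← coord_smul] at h
  change 0 < ε * form u (coord ξ) at hξ
  rw [← h, mul_left_comm] at hξ
  exact (pos_iff_pos_of_mul_pos hξ).1 ha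

theorem smul_mem_nullSlice {u n : Idx l → ℝ} {ε : ℝ} {g : G l} (hg : g ∈ flagSubgroup u n)
    {ξ : Space l} (hξ : ξ ∈ nullSlice u n ε) : g • ξ ∈ nullSlice u n ε := by
  obtain ⟨a, b, c, ha, hb, hu, hn⟩ := hg
  obtain ⟨h0, hpos⟩ := hξ
  have h := form_group g u (coord ξ)
  rw [hu, form_smul_left, ← coord_smul, h0] at h
  have h0' : form u (coord (g • ξ)) = 0 := (mul_eq_zero.1 h).resolve_left ha.ne'
  have h' := form_group g n (coord ξ)
  rw [hn, form_add_left, form_smul_left, form_smul_left, ← coord_smul, h0', mul_zero,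
    add_zero] at h'
  rw [← h', mul_left_comm] at hpos
  exact ⟨h0', (pos_iff_pos_of_mul_pos hpos).1 hb⟩

/-- If `g` and `k` move two points of `S` to the same vector, then `k⁻¹ g` carries one to the other,
`coord` being injective. -/
theorem orbit_eq_of_normalForm {R : Subgroup (G l)} {S : Set (Space l)} (x₀ : Idx l → ℝ)
    (hS : ∀ g ∈ R, ∀ ξ ∈ S, g • ξ ∈ S) (hx : ∀ ξ ∈ S, ∃ g ∈ R, g.mat *ᵥ coord ξ = x₀)
    {ξ : Space l} (hξ : ξ ∈ S) : MulAction.orbit R ξ = S := by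
  refine Set.Subset.antisymm ?_ ?_
  · rintro _ ⟨g, rfl⟩
    exact hS g g.2 ξ hξ
  · intro ζ hζ
    obtain ⟨g, hg, h1⟩ := hx ξ hξ
    obtain ⟨k, hk, h2⟩ := hx ζ hζ
    refine ⟨⟨k⁻¹ * g, R.mul_mem (R.inv_mem hk) hg⟩, ?_⟩
    change (k⁻¹ * g) • ξ = ζ
    apply coord_injective
    rw [coord_smul, mul_mulVec, h1, ← h2, inv_mulVec_mulVec]

namespace IwasawaData.HasFrame

variable {D : IwasawaData l} {w u v : Idx l → ℝ}

theorem orbit_eq_nullSlice (F : D.HasFrame w u v) {ε : ℝ} (hε : ε = 1 ∨ ε = -1) {ξ : Space l}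
    (hξ : ξ ∈ nullSlice u (basePoint l - w) ε) :
    MulAction.orbit D.R ξ = nullSlice u (basePoint l - w) ε := by
  refine orbit_eq_of_normalForm (ε • basePoint l)
    (fun g hg ξ hξ => smul_mem_nullSlice (F.R_le_flagSubgroup hg) hξ) (fun ζ hζ => ?_) hξ
  obtain ⟨a, ha, n, hn, h⟩ := F.exists_mulVec_eq_basePoint hε (form_coord ζ) hζ.1 hζ.2
  exact ⟨n * a, D.R.mul_mem (Subgroup.mem_sup_right hn) (Subgroup.mem_sup_left ha),
    by rw [mul_mulVec, h]⟩

theorem orbit_eq_halfSpace (F : D.HasFrame w u v) {ε : ℝ} (hε : ε = 1 ∨ ε = -1) {ξ : Space l}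
    (hξ : ξ ∈ halfSpace u ε) : MulAction.orbit D.R ξ = halfSpace u ε := by
  refine orbit_eq_of_normalForm (ε • (1 / 2 : ℝ) • (u + v))
    (fun g hg ξ hξ => smul_mem_halfSpace (F.R_le_flagSubgroup hg) hξ) (fun ζ hζ => ?_) hξ
  obtain ⟨a, ha, n, hn, h⟩ := F.exists_mulVec_eq_mid hε (form_coord ζ) hζ
  exact ⟨n * a, D.R.mul_mem (Subgroup.mem_sup_right hn) (Subgroup.mem_sup_left ha),
    by rw [mul_mulVec, h]⟩

theorem isClosed_nullSlice (F : D.HasFrame w u v) {ε : ℝ} (hε : ε = 1 ∨ ε = -1) :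
    IsClosed (nullSlice u (basePoint l - w) ε) := by
  -- The pairing with `n` never vanishes where that with `u` does, so the strict inequality may be
  -- relaxed to a closed condition.
  have h : nullSlice u (basePoint l - w) ε =
      {ξ | form u (coord ξ) = 0} ∩ {ξ | 0 ≤ ε * form (basePoint l - w) (coord ξ)} := by
    ext ξ
    refine ⟨fun h => ⟨h.1, h.2.le⟩, fun h => ⟨h.1, lt_of_le_of_ne h.2 (Ne.symm ?_)⟩⟩
    exact mul_ne_zero (by rcases hε with rfl | rfl <;> norm_num)
      (F.form_n_ne_zero (form_coord ξ) h.1)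
  rw [h]
  exact (isClosed_eq (continuous_form_coord u) continuous_const).inter
    (isClosed_le continuous_const (continuous_const.mul (continuous_form_coord _)))

theorem not_isClosed_halfSpace (F : D.HasFrame w u v) {ε : ℝ} (hε : ε = 1 ∨ ε = -1) :
    ¬ IsClosed (halfSpace u ε) := by
  intro hc
  have ha : form u ((1 / 2 : ℝ) • (u + v)) = 1 := by simp [F.uu, F.uv]
  -- Along `exp(t q₀) e₀ = cos t e₀ - sin t a` the pairing with `u` is `-sin t`. With the sign `-ε`
  -- in the parameter the curve is in the half space for `0 < t < 1`, but its limit `[1]` is not.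
  have hf (t : ℝ) : form u (coord (proj (exp (t • D.q₀)))) = -Real.sin t := by
    rw [coord_proj, F.q₀_eq, exp_smul_wedge_mulVec F.form_mid_basePoint F.form_mid_self,
      form_comm _ (basePoint l), F.form_mid_basePoint]
    simp only [form_sub_right, form_add_right, form_smul_right, ha, F.ub, form_basePoint_self]
    ring
  have hcont : Continuous fun t : ℝ => proj (exp ((-ε * t) • D.q₀)) :=
    QuotientGroup.continuous_mk.comp
      ((continuous_exp_smul D.q₀).comp (continuous_const.mul continuous_id))
  have hcl : IsClosed {t : ℝ | proj (exp ((-ε * t) • D.q₀)) ∈ halfSpace u ε} :=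
    hc.preimage hcont
  have hsub : Set.Ioo (0 : ℝ) 1 ⊆ {t : ℝ | proj (exp ((-ε * t) • D.q₀)) ∈ halfSpace u ε} := by
    intro t ht
    change 0 < ε * form u _
    rw [hf]
    have hs : 0 < Real.sin t :=
      Real.sin_pos_of_pos_of_lt_pi ht.1 (by linarith [ht.2, Real.pi_gt_three])
    rcases hε with rfl | rfl
    · simpa using hs
    · simpa using hs
  have h0 : (0 : ℝ) ∈ {t : ℝ | proj (exp ((-ε * t) • D.q₀)) ∈ halfSpace u ε} := by
    refine hcl.closure_subset_iff.2 hsub ?_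
    rw [closure_Ioo (by norm_num)]
    simp
  change 0 < ε * form u _ at h0
  rw [hf] at h0
  simp at h0

theorem image_proj_eq_nullSlice (F : D.HasFrame w u v) {ε : ℝ} (hε : ε = 1 ∨ ε = -1) {k : G l}
    (hk : k.mat *ᵥ basePoint l = ε • basePoint l) :
    proj '' ((D.A : Set (G l)) * (D.N : Set (G l)) * {k}) =
      nullSlice u (basePoint l - w) ε := by
  have hk' : proj k ∈ nullSlice u (basePoint l - w) ε := by
    refine ⟨?_, ?_⟩
    · rw [coord_proj, hk, form_smul_right, F.ub, mul_zero]
    · rw [coord_proj, hk, form_smul_right, form_sub_left, F.wb, form_basePoint_self]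
      rcases hε with rfl | rfl <;> norm_num
  refine Set.Subset.antisymm ?_ ?_
  · rintro _ ⟨y, hy, rfl⟩
    obtain ⟨r, hr, k', hk'', rfl⟩ := Set.mem_mul.1 hy
    obtain ⟨a, ha, n, hn, rfl⟩ := Set.mem_mul.1 hr
    have hR : a * n ∈ D.R := D.R.mul_mem (Subgroup.mem_sup_left ha) (Subgroup.mem_sup_right hn)
    rw [Set.mem_singleton_iff.1 hk'']
    have h := smul_mem_nullSlice (F.R_le_flagSubgroup hR) hk'
    rwa [MulAction.Quotient.smul_coe, smul_eq_mul] at h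
  · intro ζ hζ
    obtain ⟨a, ha, n, hn, h⟩ := F.exists_mulVec_eq_basePoint hε (form_coord ζ) hζ.1 hζ.2
    -- The normal form applies `a` first and `n` second, so its inverse already lies in the product
    -- set `A N`.
    refine ⟨a⁻¹ * n⁻¹ * k, Set.mul_mem_mul (Set.mul_mem_mul (D.A.inv_mem ha) (D.N.inv_mem hn))
      (Set.mem_singleton k), ?_⟩
    apply coord_injective
    rw [coord_proj, mul_mulVec, mul_mulVec, hk, ← h, inv_mulVec_mulVec, inv_mulVec_mulVec]

theorem clsAN_eq (F : D.HasFrame w u v) : D.clsAN = nullSlice u (basePoint l - w) 1 := by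
  rw [← F.image_proj_eq_nullSlice (k := 1) (Or.inl rfl)
    ((Matrix.one_mulVec _).trans (one_smul ℝ _).symm), clsAN, Set.singleton_one, mul_one]

theorem clsANk_eq (F : D.HasFrame w u v) : D.clsANk = nullSlice u (basePoint l - w) (-1) :=
  F.image_proj_eq_nullSlice (Or.inr rfl) (by rw [F.kθ_mulVec_basePoint, neg_one_smul])

theorem orbit_classification (F : D.HasFrame w u v) (ξ : Space l) :
    MulAction.orbit D.R ξ = D.clsAN ∨ MulAction.orbit D.R ξ = D.clsANk ∨
      MulAction.orbit D.R ξ = halfSpace u 1 ∨ MulAction.orbit D.R ξ = halfSpace u (-1) := by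
  rw [F.clsAN_eq, F.clsANk_eq]
  rcases lt_trichotomy (form u (coord ξ)) 0 with h | h | h
  · exact Or.inr (Or.inr (Or.inr (F.orbit_eq_halfSpace (Or.inr rfl)
      (show 0 < (-1 : ℝ) * _ by linarith))))
  · rcases lt_or_gt_of_ne (F.form_n_ne_zero (form_coord ξ) h) with h' | h'
    · exact Or.inr (Or.inl (F.orbit_eq_nullSlice (Or.inr rfl) ⟨h, by linarith⟩))
    · exact Or.inl (F.orbit_eq_nullSlice (Or.inl rfl) ⟨h, by linarith⟩)
  · exact Or.inr (Or.inr (Or.inl (F.orbit_eq_halfSpace (Or.inl rfl)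
      (show 0 < (1 : ℝ) * _ by linarith))))

end IwasawaData.HasFrame

/-! ### Closed orbits of `AN`, and transport by `θ` to `A N̄` -/

namespace IwasawaData

variable (D : IwasawaData l)

theorem proj_one_mem_clsAN : proj 1 ∈ D.clsAN :=
  ⟨1, ⟨1, D.A.one_mem, 1, D.N.one_mem, one_mul 1⟩, rfl⟩

theorem proj_kθ_mem_clsANk : proj D.kθ ∈ D.clsANk :=
  ⟨D.kθ, ⟨1, ⟨1, D.A.one_mem, 1, D.N.one_mem, one_mul 1⟩, _, rfl, one_mul _⟩, rfl⟩

theorem clsAN_ne_clsANk : D.clsAN ≠ D.clsANk := by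
  obtain ⟨w, u, v, F⟩ := D.exists_hasFrame
  intro h
  have h1 := D.proj_one_mem_clsAN
  have h2 := D.proj_one_mem_clsAN
  rw [h, F.clsANk_eq] at h1
  rw [F.clsAN_eq] at h2
  have := h1.2
  have := h2.2
  linarith

theorem closedOrbits_R : closedOrbits D.R = {D.clsAN, D.clsANk} := by
  obtain ⟨w, u, v, F⟩ := D.exists_hasFrame
  ext O
  constructor
  · rintro ⟨⟨ξ, rfl⟩, hc⟩
    change IsClosed (MulAction.orbit D.R ξ) at hc
    rcases F.orbit_classification ξ with h | h | h | h
    · exact Or.inl h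
    · exact Or.inr h
    · rw [h] at hc; exact absurd hc (F.not_isClosed_halfSpace (Or.inl rfl))
    · rw [h] at hc; exact absurd hc (F.not_isClosed_halfSpace (Or.inr rfl))
  · rintro (rfl | rfl)
    · have h := D.proj_one_mem_clsAN
      rw [F.clsAN_eq] at h ⊢
      exact ⟨⟨_, F.orbit_eq_nullSlice (Or.inl rfl) h⟩, F.isClosed_nullSlice (Or.inl rfl)⟩
    · have h := D.proj_kθ_mem_clsANk
      rw [F.clsANk_eq] at h ⊢
      exact ⟨⟨_, F.orbit_eq_nullSlice (Or.inr rfl) h⟩, F.isClosed_nullSlice (Or.inr rfl)⟩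

theorem isOpen_of_mem_orbits_R {O : Set (Space l)} (hO : O ∈ orbits D.R) (h1 : O ≠ D.clsAN)
    (h2 : O ≠ D.clsANk) : IsOpen O := by
  obtain ⟨w, u, v, F⟩ := D.exists_hasFrame
  obtain ⟨ξ, rfl⟩ := hO
  rcases F.orbit_classification ξ with h | h | h | h
  · exact absurd h h1
  · exact absurd h h2
  · exact (congrArg IsOpen h).mpr (isOpen_halfSpace u 1)
  · exact (congrArg IsOpen h).mpr (isOpen_halfSpace u (-1))

theorem map_θ_rootSpace (α β : ℝ) : (rootSpace D.J₁ D.J₂ α β).map (D.θ : so l →ₗ[ℝ] so l) =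
    rootSpace (-D.J₁) (-D.J₂) α β := by
  refine le_antisymm ?_ fun X hX => ?_
  · rintro _ ⟨X, hX, rfl⟩
    exact D.θ_mem_rootSpace hX
  · have h := D.opposite.θ_mem_rootSpace hX
    change D.θ X ∈ rootSpace (- -D.J₁) (- -D.J₂) α β at h
    rw [neg_neg, neg_neg] at h
    exact ⟨D.θ X, h, D.cartan.involutive X⟩

theorem opposite_N : D.opposite.N = D.Nbar := by
  rw [N, Nbar, 𝒩bar, 𝒩, 𝒩]
  simp only [Submodule.map_sup, map_θ_rootSpace]
  rfl

theorem opposite_A : D.opposite.A = D.A := by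
  have h : D.opposite.𝒜 = D.𝒜 := by
    change Submodule.span ℝ {-D.J₁, -D.J₂} = Submodule.span ℝ {D.J₁, D.J₂}
    rw [← Submodule.span_neg {D.J₁, D.J₂}, ← Set.image_neg_eq_neg, Set.image_pair]
  rw [A, A, h]

theorem opposite_R : D.opposite.R = D.Rbar := by
  rw [R, Rbar, opposite_A, opposite_N]

/-- `q₀` is symmetric under exchanging `X_{++}` and `θ X_{++}`. -/
theorem opposite_kθ : D.opposite.kθ = D.kθ := by
  have h : D.opposite.q₀ = D.q₀ := by
    change (1 / 4 : ℝ) • ((D.θ D.Xpp - sigma l (D.θ D.Xpp)) +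
      D.θ (D.θ D.Xpp - sigma l (D.θ D.Xpp))) = _
    rw [q₀, map_sub, map_sub, D.θ_comm_σ, D.θ_comm_σ, D.cartan.involutive, add_comm]
  rw [kθ, kθ, h]

theorem opposite_clsAN : D.opposite.clsAN = D.clsANbar := by
  rw [clsAN, clsANbar, opposite_A, opposite_N]

theorem opposite_clsANk : D.opposite.clsANk = D.clsANbark := by
  rw [clsANk, clsANbark, opposite_A, opposite_N, opposite_kθ]

end IwasawaData

end AdS

end

theorem mainTheorem1 (l : ℕ) (hl : 3 ≤ l) (D : AdS.IwasawaData l) :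
    -- `k_θ` implements the Cartan involution: `Ad(k_θ) = θ`
    (∀ X : AdS.so l,
      ((D.θ X : AdS.so l) : Matrix (AdS.Idx l) (AdS.Idx l) ℝ) =
        D.kθ.mat * (X : Matrix (AdS.Idx l) (AdS.Idx l) ℝ) * (D.kθ⁻¹).mat) ∧
    -- the closed orbits of `AN` and of `A N̄`; in each case the two are distinct
    AdS.closedOrbits D.R = {D.clsAN, D.clsANk} ∧ D.clsAN ≠ D.clsANk ∧
    AdS.closedOrbits D.Rbar = {D.clsANbar, D.clsANbark} ∧ D.clsANbar ≠ D.clsANbark ∧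
    -- all other orbits are open
    (∀ O ∈ AdS.orbits D.R, O ≠ D.clsAN → O ≠ D.clsANk → IsOpen O) ∧
    (∀ O ∈ AdS.orbits D.Rbar, O ≠ D.clsANbar → O ≠ D.clsANbark → IsOpen O) ∧
    -- the resulting singularity
    D.singularity = D.clsAN ∪ D.clsANk ∪ D.clsANbar ∪ D.clsANbark := by
  obtain ⟨w, u, v, F⟩ := D.exists_hasFrame
  have hc := D.closedOrbits_R
  -- The assertions on `A N̄` are those on `AN` for the opposite data, which has the same `A` and
  -- `k_θ` and has `N̄` as its `N`.
  have hc' := D.opposite.closedOrbits_R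
  have hne := D.opposite.clsAN_ne_clsANk
  have ho := fun O => D.opposite.isOpen_of_mem_orbits_R (O := O)
  rw [D.opposite_R, D.opposite_clsAN, D.opposite_clsANk] at hc'
  rw [D.opposite_clsAN, D.opposite_clsANk] at hne
  rw [D.opposite_R, D.opposite_clsAN, D.opposite_clsANk] at ho
  refine ⟨F.θ_eq_conj, hc, D.clsAN_ne_clsANk, hc', hne,
    fun O => D.isOpen_of_mem_orbits_R, ho, ?_⟩
  rw [AdS.IwasawaData.singularity, hc, hc', Set.sUnion_union, Set.sUnion_pair, Set.sUnion_pair,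
    Set.union_assoc (D.clsAN ∪ D.clsANk)]
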